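/- **Setting.** Let $x_1,x_2,\dots$ be commuting variables and $\theta_1,\theta_2,\dots$ anticommuting variables ($\theta_i\theta_j=-\theta_j\theta_i$, $\theta_i^2=0$, $x_i\theta_j=\theta_jx_i$). For $N\ge 0$, $\mathbb{Z}[x_1,\dots,x_N,\theta_1,\dots,\theta_N]^{S_N}$ is the ring of superpolynomials invariant under the diagonal action $\mathcal K_\sigma: x_i\mapsto x_{\sigma(i)},\ \theta_i\mapsto\theta_{\sigma(i)}$, $\sigma\in S_N$. Let $\mathscr P^{S_\infty}_{(n|m)}(\mathbb{Z})$ be the $\mathbb{Z}$-module of symmetric superfunctions in infinitely many variables that are homogeneous of degree $n$ in $x$ and $m$ in $\theta$, i.e. the inverse limit over $N$ of the symmetric superpolynomials of degree $(n|m)$ in $N$ pairs of variables, under the maps setting $x_{N+1}=\theta_{N+1}=0$. A superpartition $\Lambda=(\Lambda_1,\dots,\Lambda_m;\Lambda_{m+1},\dots,\Lambda_\ell)$ of $(n|m)$ consists of integers $\Lambda_1>\dots>\Lambda_m\ge 0$ and a partition $\Lambda_{m+1}\ge\dots\ge\Lambda_\ell>0$, of total sum $n$ (for $n=m=0$ there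 is exactly one, the empty one); its length is $\ell$. Let $\Lambda^c$ be the composition $(\Lambda_1,\dots,\Lambda_\ell)$ followed by zeros, and $\Lambda^*$ its non-increasing rearrangement. The diagram $D[\Lambda]$ is the Ferrers diagram of $\Lambda^*$ with, for each $i\le m$, a circle added at the end of the row of the leftmost part equal to $\Lambda_i$ in $\Lambda^*$. The conjugate $\Lambda'$ is the superpartition whose diagram is the transpose of $D[\Lambda]$. For a composition $\lambda$ let $\lambda^+$ be its non-increasing rearrangement and $w_\lambda$ the permutation of minimal length with $\lambda=w_\lambda\lambda^+$. For superpartitions, $\Omega\le\Lambda$ (Bruhat order) means that, with $\mu=\Omega^c$ and $\lambda=\Lambda^c$, either $\mu^+<\lambda^+$ in the dominance order, or $\mu^+=\lambda^+$ and $w_\lambda$ is a subword of $w_\mu$ (the Bruhat order on permutations). We write $\Omega<\Lambda$ if $\Omega\le\Lambda$ and $\Omega\ne\Lambda$. Let $m_\Lambda$ be the sum of the distinct terms $\mathcal K_\sigma(\theta_1\cdots\theta_m x_1^{\Lambda_1}x_2^{\Lambda_2}\cdots)$ over permutations $\sigma$ of the variables (in $N$ pairs of variables, it is $0$ if $N<\ell$).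 Put $e_n=\sum_{\#J=n}\prod_{j\in J}x_j$ and $\tilde e_n=\sum_i\sum_{\#J=n,\,i\notin J}\theta_i\prod_{j\in J}x_j$ for $n\ge0$ (so $e_0=1$, $\tilde e_0=\sum_i\theta_i$), and $$e_\Lambda=\tilde e_{\Lambda_1}\cdots\tilde e_{\Lambda_m}\,e_{\Lambda_{m+1}}\cdots e_{\Lambda_\ell}.$$ **Theorem.** Let $n,m\ge 0$. 1. For every superpartition $\Lambda$ of $(n|m)$ there are integers $N_\Lambda^\Omega$ such that, in infinitely many variables, $$\tilde e_{\Lambda_m}\cdots\tilde e_{\Lambda_1}\,e_{\Lambda_{m+1}}\cdots e_{\Lambda_\ell}=m_{\Lambda'}+\sum_{\Omega<\Lambda'}N_\Lambda^\Omega\, m_\Omega ,$$ where the sum is over superpartitions $\Omega$ of $(n|m)$. 2. The family $(e_\Lambda)$, with $\Lambda$ running over the superpartitions of $(n|m)$, is a $\mathbb{Z}$-basis of $\mathscr P^{S_\infty}_{(n|m)}(\mathbb{Z})$. 3. For every $N\ge0$, $$\mathbb{Z}[x_1,\dots,x_N,\theta_1,\dots,\theta_N]^{S_N}=\mathbb{Z}[e_1,\dots,e_N,\tilde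 e_0,\dots,\tilde e_{N-1}],$$ where $e_i,\tilde e_i$ are taken in $N$ pairs of variables, and these generators are algebraically independent over $\mathbb{Z}$: there is a $\mathbb{Z}$-algebra isomorphism from $\mathbb{Z}[x_1,\dots,x_N,\theta_1,\dots,\theta_N]$ onto this ring with $x_i\mapsto e_i$ and $\theta_i\mapsto\tilde e_{i-1}$ for $1\le i\le N$. -/

import Mathlib

open scoped TensorProduct

/-! ### Superpartitions -/

/-- A superpartition `(Λ₁, …, Λ_m ; Λ_{m+1}, …, Λ_ℓ)`: a strictly decreasing sequence `anti` of
non-negative integers followed by a partition `sym`.  Superpartitions that differ only by trailing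
zeros of the symmetric component are the same, so `sym` stores only its positive parts. -/
@[ext] structure SuperPartition where
  anti : List ℕ
  sym : List ℕ
  anti_sorted : anti.Pairwise (· > ·)
  sym_sorted : sym.Pairwise (· ≥ ·)
  sym_pos : ∀ p ∈ sym, 0 < p

/-- A finite sequence of non-negative integers, continued by zeros. -/
def compSeq (l : List ℕ) (i : ℕ) : ℕ := l.getD i 0

/-- The non-increasing rearrangement of a composition. -/
def compSort (l : List ℕ) : List ℕ := l.mergeSort (fun a b => decide (b ≤ a))

namespace SuperPartition

/-- The composition `Λᶜ`: the semicolon is replaced by a comma. -/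
def comp (Λ : SuperPartition) : List ℕ := Λ.anti ++ Λ.sym

/-- The bosonic degree `|Λ|`. -/
def degree (Λ : SuperPartition) : ℕ := Λ.comp.sum

/-- The fermionic degree. -/
def fermionicDegree (Λ : SuperPartition) : ℕ := Λ.anti.length

/-- The length: fermionic degree plus the number of positive parts of the symmetric component. -/
def length (Λ : SuperPartition) : ℕ := Λ.anti.length + Λ.sym.length

/-- The partition `Λ*` (a part `0` of `Λᵃ` is kept as a last entry `0`). -/
def star (Λ : SuperPartition) : List ℕ := compSort Λ.comp

/-- The boxes of the diagram `D[Λ]`, as pairs (row, column), numbered from `0`. -/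
def boxes (Λ : SuperPartition) : Set (ℕ × ℕ) := {p | p.2 < compSeq Λ.star p.1}

/-- The circles of the diagram `D[Λ]`: for each part `a` of `Λᵃ`, there is a circle at the end of
the row of the leftmost `a` in `Λ*`. -/
def circles (Λ : SuperPartition) : Set (ℕ × ℕ) := {p | p.2 ∈ Λ.anti ∧ p.1 = Λ.star.idxOf p.2}

/-- The length of column `c` of `D[Λ]`, without circles. -/
def colLength (Λ : SuperPartition) (c : ℕ) : ℕ := Λ.comp.countP (fun p => decide (c < p))

theorem colLength_anti (Λ : SuperPartition) {c d : ℕ} (h : c ≤ d) :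
    Λ.colLength d ≤ Λ.colLength c := by
  unfold colLength
  apply List.countP_mono_left
  intro x _ hx
  simp only [decide_eq_true_eq] at hx ⊢
  omega

theorem colLength_lt (Λ : SuperPartition) {c d : ℕ} (h : c < d) (hd : d ∈ Λ.comp) :
    Λ.colLength d < Λ.colLength c := by
  unfold colLength
  generalize Λ.comp = l at hd
  induction l with
  | nil => simp at hd
  | cons a l ih =>
    have hmono : l.countP (fun p => decide (d < p)) ≤ l.countP (fun p => decide (c < p)) := by
      apply List.countP_mono_left
      intro x _ hx
      simp only [decide_eq_true_eq] at hx ⊢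
      omega
    simp only [List.countP_cons, decide_eq_true_eq]
    rcases List.mem_cons.1 hd with rfl | hd
    · simp [h]; omega
    · have := ih hd
      split_ifs <;> omega

theorem colLength_pos (Λ : SuperPartition) {c : ℕ} (h : c < Λ.comp.foldr max 0) :
    0 < Λ.colLength c := by
  unfold colLength
  rw [List.countP_pos_iff]
  generalize Λ.comp = l at h
  induction l with
  | nil => simp at h
  | cons a l ih =>
    simp only [List.foldr_cons] at h
    rcases lt_max_iff.1 h with h | h
    · exact ⟨a, by simp, by simpa using h⟩
    · obtain ⟨b, hb, hb'⟩ := ih h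
      exact ⟨b, by simp [hb], hb'⟩

/-- The conjugate `Λ'`.  The rows of its diagram are the columns of `D[Λ]`; column `c` of `D[Λ]`
ends with a circle exactly when `c` is a part of `Λᵃ`.  That the diagram of `Λ'` is the transpose
of the diagram of `Λ` is proved in `boxes_conj` and `circles_conj` below. -/
def conj (Λ : SuperPartition) : SuperPartition where
  anti := Λ.anti.reverse.map Λ.colLength
  sym := ((List.range (Λ.comp.foldr max 0)).filter (fun c => decide (c ∉ Λ.anti))).map Λ.colLength
  anti_sorted := by
    rw [List.pairwise_map, List.pairwise_reverse]
    refine List.Pairwise.imp_of_mem ?_ Λ.anti_sorted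
    intro a b ha _ hab
    exact Λ.colLength_lt hab (List.mem_append_left _ ha)
  sym_sorted := by
    rw [List.pairwise_map]
    refine List.Pairwise.filter _ ?_
    refine List.Pairwise.imp ?_ List.pairwise_lt_range
    intro a b hab
    exact Λ.colLength_anti hab.le
  sym_pos := by
    intro p hp
    simp only [List.mem_map, List.mem_filter, List.mem_range] at hp
    obtain ⟨c, ⟨hc, _⟩, rfl⟩ := hp
    exact Λ.colLength_pos hc

end SuperPartition

theorem compSort_perm (l : List ℕ) : (compSort l).Perm l := List.mergeSort_perm _ _

theorem compSort_sorted (l : List ℕ) : (compSort l).Pairwise (· ≥ ·) := by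
  have := List.pairwise_mergeSort (le := fun a b : ℕ => decide (b ≤ a))
    (by intro a b c; simp; omega) (by intro a b; simp; omega) l
  simpa [compSort] using this

theorem lt_compSeq_iff {l : List ℕ} (hl : l.Pairwise (· ≥ ·)) (r c : ℕ) :
    c < compSeq l r ↔ r < l.countP (fun p => decide (c < p)) := by
  unfold compSeq
  induction l generalizing r with
  | nil => simp
  | cons a l ih =>
    rw [List.pairwise_cons] at hl
    have ih := ih hl.2
    by_cases hca : c < a
    · cases r with
      | zero => simp [hca]
      | succ r =>
        have := ih r
        simpa [hca] using this
    · have h0 : l.countP (fun p => decide (c < p)) = 0 := by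
        rw [List.countP_eq_zero]
        intro p hp
        have := hl.1 p hp
        simp only [decide_eq_true_eq]
        omega
      cases r with
      | zero => simp [hca, h0]
      | succ r =>
        have := ih r
        rw [h0] at this
        simpa [hca, h0] using this

theorem idxOf_eq_countP {l : List ℕ} (hl : l.Pairwise (· ≥ ·)) {a : ℕ} (ha : a ∈ l) :
    l.idxOf a = l.countP (fun p => decide (a < p)) := by
  induction l with
  | nil => simp at ha
  | cons b l ih =>
    rw [List.pairwise_cons] at hl
    by_cases hab : b = a
    · subst hab
      have h0 : l.countP (fun p => decide (b < p)) = 0 := by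
        rw [List.countP_eq_zero]
        intro p hp
        have := hl.1 p hp
        simp only [decide_eq_true_eq]
        omega
      simp [h0]
    · have ha' : a ∈ l := by
        rcases List.mem_cons.1 ha with h | h
        · exact absurd h.symm hab
        · exact h
      have hlt : a < b := lt_of_le_of_ne (hl.1 a ha') (Ne.symm hab)
      rw [List.idxOf_cons_ne _ hab, ih hl.2 ha']
      simp [hlt]

namespace SuperPartition

theorem mem_boxes (Λ : SuperPartition) (r c : ℕ) : (r, c) ∈ Λ.boxes ↔ r < Λ.colLength c := by
  have := lt_compSeq_iff (compSort_sorted Λ.comp) r c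
  rw [(compSort_perm Λ.comp).countP_eq] at this
  exact this

theorem mem_circles (Λ : SuperPartition) (r c : ℕ) :
    (r, c) ∈ Λ.circles ↔ c ∈ Λ.anti ∧ r = Λ.colLength c := by
  unfold circles
  refine and_congr_right fun hc => ?_
  have hm : c ∈ Λ.star := (compSort_perm Λ.comp).mem_iff.2 (List.mem_append_left _ hc)
  have h := idxOf_eq_countP (compSort_sorted Λ.comp) hm
  rw [(compSort_perm Λ.comp).countP_eq] at h
  change r = Λ.star.idxOf c ↔ r = Λ.colLength c
  rw [show Λ.star.idxOf c = Λ.colLength c from h]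

theorem colLength_conj (Λ : SuperPartition) (r : ℕ) :
    Λ.conj.colLength r = compSeq Λ.star r := by
  set M := Λ.comp.foldr max 0 with hM
  have hle : ∀ l : List ℕ, ∀ p ∈ l, p ≤ l.foldr max 0 := by
    intro l
    induction l with
    | nil => simp
    | cons a l ih =>
      intro p hp
      rcases List.mem_cons.1 hp with rfl | hp
      · simp
      · exact (ih p hp).trans (by simp)
  -- the index list of the columns
  let I : List ℕ := Λ.anti.reverse ++ (List.range M).filter (fun c => decide (c ∉ Λ.anti))
  have hI : Λ.conj.comp = I.map Λ.colLength := by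
    simp [I, comp, conj, hM]
  have hnd : I.Nodup := by
    refine List.Nodup.append ?_ (List.nodup_range.filter _) ?_
    · rw [List.nodup_reverse]
      exact Λ.anti_sorted.imp (fun h => ne_of_gt h)
    · intro a ha hb
      simp only [List.mem_reverse] at ha
      simp [ha] at hb
  have hmem : ∀ c, c ∈ I ∧ r < Λ.colLength c ↔ c < compSeq Λ.star r := by
    intro c
    have hb := Λ.mem_boxes r c
    have hb' : c < compSeq Λ.star r ↔ r < Λ.colLength c := hb
    rw [hb']
    refine ⟨fun h => h.2, fun h => ⟨?_, h⟩⟩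
    have hpos : 0 < Λ.colLength c := by omega
    unfold colLength at hpos
    rw [List.countP_pos_iff] at hpos
    obtain ⟨p, hp, hcp⟩ := hpos
    have := hle _ p hp
    simp only [decide_eq_true_eq] at hcp
    by_cases hc : c ∈ Λ.anti
    · simp [I, hc]
    · simp only [I, List.mem_append, List.mem_reverse, List.mem_filter, List.mem_range, hc]
      simp
      omega
  have : (I.filter (fun c => decide (r < Λ.colLength c))).Perm
      (List.range (compSeq Λ.star r)) := by
    rw [List.perm_ext_iff_of_nodup (hnd.filter _) List.nodup_range]
    intro c
    rw [List.mem_filter, List.mem_range, ← hmem c]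
    simp
  have hlen := this.length_eq
  rw [List.length_range] at hlen
  rw [← hlen]
  unfold colLength
  rw [hI, List.countP_map, List.countP_eq_length_filter]
  rfl

/-- The boxes of `D[Λ']` are the transposes of the boxes of `D[Λ]`. -/
theorem boxes_conj (Λ : SuperPartition) (r c : ℕ) : (r, c) ∈ Λ.conj.boxes ↔ (c, r) ∈ Λ.boxes := by
  rw [mem_boxes, colLength_conj]
  rfl

/-- The circles of `D[Λ']` are the transposes of the circles of `D[Λ]`. -/
theorem circles_conj (Λ : SuperPartition) (r c : ℕ) :
    (r, c) ∈ Λ.conj.circles ↔ (c, r) ∈ Λ.circles := by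
  have key : ∀ a ∈ Λ.anti, compSeq Λ.star (Λ.colLength a) = a := by
    intro a ha
    have hm : a ∈ Λ.star := (compSort_perm Λ.comp).mem_iff.2 (List.mem_append_left _ ha)
    have hidx : Λ.star.idxOf a = Λ.colLength a := (Λ.mem_circles _ a).1 ⟨ha, rfl⟩ |>.2
    have hlt := List.idxOf_lt_length_of_mem hm
    rw [← hidx]
    unfold compSeq
    rw [List.getD_eq_getElem _ _ hlt, List.getElem_idxOf]
  rw [mem_circles, mem_circles, colLength_conj]
  simp only [conj, List.mem_map, List.mem_reverse]
  constructor
  · rintro ⟨⟨a, ha, rfl⟩, rfl⟩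
    rw [key a ha]
    exact ⟨ha, rfl⟩
  · rintro ⟨hr, rfl⟩
    exact ⟨⟨r, hr, rfl⟩, (key r hr).symm⟩

end SuperPartition

/-- The set `SPar(n|m)` of superpartitions of degree `n` in the fermionic sector `m`. -/
abbrev SPar (n m : ℕ) : Type :=
  {Λ : SuperPartition // Λ.degree = n ∧ Λ.fermionicDegree = m}

/-! ### The Bruhat order -/

/-- Strict dominance order on non-increasing sequences of the same degree:
`dominanceLT b a` means `b < a`. -/
def dominanceLT (b a : List ℕ) : Prop :=
  b.sum = a.sum ∧
    (∀ k, ∑ i ∈ Finset.range k, compSeq b i ≤ ∑ i ∈ Finset.range k, compSeq a i) ∧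
    compSeq b ≠ compSeq a

/-- The permutation `s_{i₁} s_{i₂} ⋯ s_{i_k}` given by a word in the simple transpositions
`s_i = (i, i+1)`. -/
def wordPerm (u : List ℕ) : Equiv.Perm ℕ := (u.map fun i => Equiv.swap i (i + 1)).prod

/-- The word `u` represents some `w` with `a = w a⁺`, where `w` moves the entry in position `i` to
position `w i`. -/
def WordSorts (u : List ℕ) (a : List ℕ) : Prop :=
  ∀ i, compSeq a (wordPerm u i) = compSeq (compSort a) i

/-- The word `u` is a reduced word of `w_a`, the permutation of minimal length with
`a = w_a a⁺`. -/
def IsMinimalWord (u : List ℕ) (a : List ℕ) : Prop :=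
  WordSorts u a ∧ ∀ v, WordSorts v a → u.length ≤ v.length

/-- The Bruhat order on compositions, `compBruhatLE b a` meaning `b ≤ a`: either `b⁺ < a⁺` in the
dominance order, or `b⁺ = a⁺` and `w_a` is a subword of `w_b`. -/
def compBruhatLE (b a : List ℕ) : Prop :=
  dominanceLT (compSort b) (compSort a) ∨
    (compSeq (compSort b) = compSeq (compSort a) ∧
      ∃ u v, IsMinimalWord u a ∧ IsMinimalWord v b ∧ u.Sublist v)

/-- The Bruhat order `Ω ≤ Λ` on superpartitions. -/
def SuperPartition.BruhatLE (Ω Λ : SuperPartition) : Prop := compBruhatLE Ω.comp Λ.comp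

/-- The strict Bruhat order `Ω < Λ` on superpartitions. -/
def SuperPartition.BruhatLT (Ω Λ : SuperPartition) : Prop := Ω.BruhatLE Λ ∧ Ω ≠ Λ

/-! ### Superpolynomials -/

/-- The ring of superpolynomials in `x₁, …, x_N, θ₁, …, θ_N` with integer coefficients: the
Grassmann algebra on the `θ_i`, with coefficients extended from `ℤ` to `ℤ[x₁, …, x_N]`. -/
abbrev SuperPoly (N : ℕ) : Type :=
  MvPolynomial (Fin N) ℤ ⊗[ℤ] ExteriorAlgebra ℤ (Fin N → ℤ)

noncomputable section

namespace SuperPoly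

/-- A polynomial in `x` alone, as a superpolynomial. -/
def ofPoly {N : ℕ} (p : MvPolynomial (Fin N) ℤ) : SuperPoly N := p ⊗ₜ 1

/-- The commuting variable `x_i`. -/
def x {N : ℕ} (i : Fin N) : SuperPoly N := ofPoly (MvPolynomial.X i)

/-- The anticommuting variable `θ_i`. -/
def θ {N : ℕ} (i : Fin N) : SuperPoly N := 1 ⊗ₜ ExteriorAlgebra.ι ℤ (Pi.single i 1)

/-- The diagonal action `𝒦_σ` of a permutation: `x_i ↦ x_{σ i}` and `θ_i ↦ θ_{σ i}`. -/
def perm {N : ℕ} (σ : Equiv.Perm (Fin N)) : SuperPoly N →ₐ[ℤ] SuperPoly N :=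
  Algebra.TensorProduct.map (MvPolynomial.rename σ)
    (ExteriorAlgebra.map (LinearMap.funLeft ℤ ℤ σ.symm))

theorem perm_x {N : ℕ} (σ : Equiv.Perm (Fin N)) (i : Fin N) : perm σ (x i) = x (σ i) := by
  simp [perm, x, ofPoly]

theorem perm_θ {N : ℕ} (σ : Equiv.Perm (Fin N)) (i : Fin N) : perm σ (θ i) = θ (σ i) := by
  have h : LinearMap.funLeft ℤ ℤ σ.symm (Pi.single i 1) = Pi.single (σ i) (1 : ℤ) := by
    ext j
    simp [LinearMap.funLeft_apply, Pi.single_apply, Equiv.symm_apply_eq]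
  simp [perm, θ, h]

/-- Setting the last pair of variables to zero: `x_{N+1} = θ_{N+1} = 0`. -/
def restrict (N : ℕ) : SuperPoly (N + 1) →ₐ[ℤ] SuperPoly N :=
  Algebra.TensorProduct.map
    (MvPolynomial.aeval (Fin.lastCases 0 MvPolynomial.X))
    (ExteriorAlgebra.map (LinearMap.funLeft ℤ ℤ Fin.castSucc))

theorem restrict_x (N : ℕ) (i : Fin N) : restrict N (x i.castSucc) = x i := by
  simp [restrict, x, ofPoly]

theorem restrict_x_last (N : ℕ) : restrict N (x (Fin.last N)) = 0 := by
  simp [restrict, x, ofPoly]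

theorem restrict_θ (N : ℕ) (i : Fin N) : restrict N (θ i.castSucc) = θ i := by
  have h : LinearMap.funLeft ℤ ℤ Fin.castSucc (Pi.single i.castSucc 1) =
      (Pi.single i (1 : ℤ) : Fin N → ℤ) := by
    ext j
    simp [LinearMap.funLeft_apply, Pi.single_apply]
  simp [restrict, θ, h]

theorem restrict_θ_last (N : ℕ) : restrict N (θ (Fin.last N)) = 0 := by
  have h : LinearMap.funLeft ℤ ℤ Fin.castSucc (Pi.single (Fin.last N) 1) =
      (0 : Fin N → ℤ) := by
    ext j
    simp [LinearMap.funLeft_apply, Fin.castSucc_ne_last]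
  simp [restrict, θ, h]

/-- The superpolynomials that are homogeneous of degree `n` in `x` and of degree `m` in `θ`:
integer combinations of the monomials `x^μ θ_{j_1} ⋯ θ_{j_m}` with `|μ| = n`. -/
def homogeneous (N n m : ℕ) : Submodule ℤ (SuperPoly N) :=
  Submodule.span ℤ {f | ∃ (μ : Fin N →₀ ℕ) (j : Fin m → Fin N), μ.degree = n ∧
    f = ofPoly (MvPolynomial.monomial μ 1) * (List.ofFn fun k => θ (j k)).prod}

/-- The ring of symmetric superpolynomials in `N` pairs of variables. -/
def symmetric (N : ℕ) : Subalgebra ℤ (SuperPoly N) :=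
  ⨅ σ : Equiv.Perm (Fin N), AlgHom.equalizer (perm σ) (AlgHom.id ℤ (SuperPoly N))

theorem mem_symmetric {N : ℕ} (f : SuperPoly N) : f ∈ symmetric N ↔ ∀ σ, perm σ f = f := by
  simp [symmetric, Algebra.mem_iInf, AlgHom.mem_equalizer]

/-- The bosonic elementary symmetric polynomial `e_n` in `N` pairs of variables. -/
def e (N n : ℕ) : SuperPoly N :=
  ∑ J ∈ Finset.powersetCard n Finset.univ, ofPoly (∏ j ∈ J, MvPolynomial.X j)

/-- The fermionic elementary symmetric polynomial `ẽ_n` in `N` pairs of variables. -/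
def eTilde (N n : ℕ) : SuperPoly N :=
  ∑ i : Fin N, ∑ J ∈ Finset.powersetCard n (Finset.univ.erase i),
    θ i * ofPoly (∏ j ∈ J, MvPolynomial.X j)

/-- The monomial `θ₁ ⋯ θ_m x^Λ` in `N ≥ ℓ(Λ)` pairs of variables. -/
def leading {N : ℕ} (Λ : SuperPartition) (h : Λ.length ≤ N) : SuperPoly N :=
  (List.ofFn fun k : Fin Λ.anti.length =>
      θ (Fin.castLE ((Nat.le_add_right _ _).trans h) k)).prod *
    ofPoly (∏ i : Fin N, MvPolynomial.X i ^ compSeq Λ.comp i)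

open Classical in
/-- The monomial symmetric superpolynomial `m_Λ` in `N` pairs of variables: the sum of the distinct
elements `𝒦_σ (θ₁ ⋯ θ_m x^Λ)`, `σ ∈ S_N`; it is zero when `N < ℓ(Λ)`. -/
def mono (N : ℕ) (Λ : SuperPartition) : SuperPoly N :=
  if h : Λ.length ≤ N then
    ∑ f ∈ Finset.univ.image (fun σ : Equiv.Perm (Fin N) => perm σ (leading Λ h)), f
  else 0

end SuperPoly

/-! ### Symmetric superfunctions in infinitely many variables -/

/-- The module of symmetric superfunctions of degree `(n|m)` in infinitely many variables
`x₁, x₂, …, θ₁, θ₂, …`, as the inverse limit over `N` of the modules of symmetric superpolynomials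
of degree `(n|m)` in `N` pairs of variables.  Products are taken in the ring `∀ N, SuperPoly N`. -/
def symSuperfunction (n m : ℕ) : Submodule ℤ (∀ N, SuperPoly N) where
  carrier := {f | ∀ N, f N ∈ SuperPoly.homogeneous N n m ∧ f N ∈ SuperPoly.symmetric N ∧
    SuperPoly.restrict N (f (N + 1)) = f N}
  zero_mem' := fun N => ⟨Submodule.zero_mem _, Subalgebra.zero_mem _, by simp⟩
  add_mem' := fun {f g} hf hg N =>
    ⟨Submodule.add_mem _ (hf N).1 (hg N).1, Subalgebra.add_mem _ (hf N).2.1 (hg N).2.1, by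
      rw [Pi.add_apply, Pi.add_apply, map_add, (hf N).2.2, (hg N).2.2]⟩
  smul_mem' := fun c f hf N =>
    ⟨Submodule.smul_mem _ c (hf N).1, Subalgebra.smul_mem _ (hf N).2.1 c, by
      rw [Pi.smul_apply, Pi.smul_apply, map_smul, (hf N).2.2]⟩

/-- The monomial symmetric superfunction `m_Λ`. -/
def mSuper (Λ : SuperPartition) : ∀ N, SuperPoly N := fun N => SuperPoly.mono N Λ

/-- The bosonic elementary symmetric function `e_n`. -/
def eSuper (n : ℕ) : ∀ N, SuperPoly N := fun N => SuperPoly.e N n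

/-- The fermionic elementary symmetric function `ẽ_n`. -/
def eTildeSuper (n : ℕ) : ∀ N, SuperPoly N := fun N => SuperPoly.eTilde N n

/-- `e_Λ = ẽ_{Λ₁} ⋯ ẽ_{Λ_m} e_{Λ_{m+1}} ⋯ e_{Λ_ℓ}`. -/
def eProd (Λ : SuperPartition) : ∀ N, SuperPoly N :=
  (Λ.anti.map eTildeSuper).prod * (Λ.sym.map eSuper).prod

/-- `e_Λ` with the fermionic factors reversed: `ẽ_{Λ_m} ⋯ ẽ_{Λ₁} e_{Λ_{m+1}} ⋯ e_{Λ_ℓ}`. -/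
def eProdRev (Λ : SuperPartition) : ∀ N, SuperPoly N :=
  (Λ.anti.reverse.map eTildeSuper).prod * (Λ.sym.map eSuper).prod

end

/-! ### Lists and superpartitions -/

/-! The products of elementary superfunctions are unitriangular, up to conjugation, over the
monomial superfunctions.

Choosing one term from every factor of `eProdRev Λ` amounts to filling the columns of `D[Λ]` with
sets of letters and putting into each fermionic column a circled letter outside its set
(`prod_elementary_eq_sum`). The filling contributes the monomial whose exponents are its content and
whose `θ`'s are its circled letters. The content is dominated by the row lengths of the columns,
which are the parts of `Λ'` (`sum_content_le`). Equality holds only for the filling of each column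
by an initial segment (`filling_eq_range`), after relabelling by a permutation that sorts `Ω`. In
that case only the circles can move, and each must lie at or beyond the end of its column, so the
fermionic parts of `Ω` are at most those of `Λ'` (`filling_of_coeff_ne_zero`, `le_of_le_comp_perm`).
For `Ω = Λ'` a single filling remains, with coefficient `1` (`monoCoeff_conj_eProdRev`).

Coefficients in the family `m_Ω` are read off as coefficients of leading monomials. They determine a
symmetric superpolynomial, because every monomial can be sorted to a leading one, or else two of its
`θ`'s carry equal exponents and its coefficient is its own negative
(`eq_zero_of_monoCoeff_eq_zero`).

The order produced by fillings is recorded as `Below`. It is transitive for elementary reasons and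
implies the Bruhat order, by comparing explicit reduced words (`sortingWord`, `Below.bruhatLT`).
Induction along `Below` puts every `m_Ω` into any subgroup containing the products
(`mSuper_mem_of_eProdRev_mem`), and a maximal-term argument gives independence
(`eq_zero_of_triangular`). Passing from `eProdRev` to `eProd` costs a sign.

For finite `N`, the map `toElementary` sends the monomial basis to products `eProdRev Λ` for which
`Λ'` has length at most `N`. Their leading coefficients are therefore visible in `N` pairs of
variables, which yields injectivity; surjectivity onto the invariants follows from the expansion in
the `m_Ω`. -/

theorem eq_of_countP_lt_eq {l l' : List ℕ} (hl : l.Pairwise (· ≥ ·)) (hl' : l'.Pairwise (· ≥ ·))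
    (hp : ∀ p ∈ l, 0 < p) (hp' : ∀ p ∈ l', 0 < p)
    (h : ∀ c, l.countP (fun p => decide (c < p)) = l'.countP (fun p => decide (c < p))) :
    l = l' := by
  -- Positivity of the parts makes the count at `0` the full length; trailing zeros would otherwise
  -- go unnoticed.
  have hlen : l.length = l'.length := by
    have := h 0
    rwa [List.countP_eq_length.2 (by simpa using hp),
      List.countP_eq_length.2 (by simpa using hp')] at this
  have hseq : ∀ r, compSeq l r = compSeq l' r := fun r => by
    refine eq_of_forall_lt_iff fun c => ?_
    rw [lt_compSeq_iff hl, lt_compSeq_iff hl', h]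
  refine List.ext_getElem hlen fun i h₁ h₂ => ?_
  have := hseq i
  rwa [compSeq, compSeq, List.getD_eq_getElem _ _ h₁, List.getD_eq_getElem _ _ h₂] at this

theorem sum_eq_sum_countP_lt (l : List ℕ) {M : ℕ} (hM : ∀ p ∈ l, p ≤ M) :
    l.sum = ∑ c ∈ Finset.range M, l.countP (fun p => decide (c < p)) := by
  induction l with
  | nil => simp
  | cons a l ih =>
    rw [List.forall_mem_cons] at hM
    simp only [List.countP_cons, List.sum_cons, Finset.sum_add_distrib, ← ih hM.2]
    simp only [decide_eq_true_eq, Finset.sum_boole]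
    have : (Finset.range M).filter (fun c => c < a) = Finset.range a := by
      ext c; simp; omega
    rw [this]; simp [add_comm]

theorem sum_eq_sum_compSeq (l : List ℕ) {N : ℕ} (hN : l.length ≤ N) :
    l.sum = ∑ i ∈ Finset.range N, compSeq l i := by
  induction l generalizing N with
  | nil => simp [compSeq]
  | cons a l ih =>
    obtain ⟨N, rfl⟩ : ∃ k, N = k + 1 := ⟨N - 1, by simp at hN; omega⟩
    rw [Finset.sum_range_succ', List.sum_cons, ih (N := N) (by simpa using hN)]
    simp [compSeq, add_comm]

theorem compSeq_eq_zero {l : List ℕ} {i : ℕ} (h : l.length ≤ i) : compSeq l i = 0 := by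
  simp [compSeq, h]

theorem lt_length_of_compSeq_pos {l : List ℕ} {i : ℕ} (h : 0 < compSeq l i) : i < l.length := by
  by_contra hi
  rw [compSeq_eq_zero (not_lt.1 hi)] at h
  exact lt_irrefl _ h

theorem le_foldr_max {l : List ℕ} {p : ℕ} (hp : p ∈ l) : p ≤ l.foldr max 0 := by
  induction l with
  | nil => simp at hp
  | cons a l ih =>
    rcases List.mem_cons.1 hp with rfl | hp
    · simp
    · exact (ih hp).trans (by simp)

/-! ### Conjugation, degree and length of superpartitions -/

namespace SuperPartition

theorem anti_nodup (Λ : SuperPartition) : Λ.anti.Nodup := Λ.anti_sorted.imp fun h => ne_of_gt h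

theorem eq_of_colLength_eq {Λ Ω : SuperPartition} (ha : Λ.anti = Ω.anti)
    (hc : ∀ c, Λ.colLength c = Ω.colLength c) : Λ = Ω := by
  refine SuperPartition.ext ha
    (eq_of_countP_lt_eq Λ.sym_sorted Ω.sym_sorted Λ.sym_pos Ω.sym_pos fun c => ?_)
  have := hc c
  simpa [colLength, comp, List.countP_append, ha] using this

/-- Circles and boxes determine a superpartition: a strictly decreasing list is determined by its
set of entries, and the column lengths then determine the positive parts of `sym`. -/
theorem eq_of_mem_anti_iff {Λ Ω : SuperPartition} (ha : ∀ a, a ∈ Λ.anti ↔ a ∈ Ω.anti)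
    (hc : ∀ c, Λ.colLength c = Ω.colLength c) : Λ = Ω := by
  refine eq_of_colLength_eq ?_ hc
  refine List.Perm.eq_of_pairwise (le := (· > ·)) ?_ Λ.anti_sorted Ω.anti_sorted
    ((List.perm_ext_iff_of_nodup Λ.anti_nodup Ω.anti_nodup).2 ha)
  intro a b _ _ hab hba
  omega

theorem lt_star_iff (Λ : SuperPartition) (r c : ℕ) :
    c < compSeq Λ.star r ↔ r < Λ.colLength c := Λ.mem_boxes r c

theorem star_conj (Λ : SuperPartition) (c : ℕ) : compSeq Λ.conj.star c = Λ.colLength c := by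
  refine eq_of_forall_lt_iff fun r => ?_
  rw [lt_star_iff, colLength_conj, lt_star_iff]

theorem colLength_conj_conj (Λ : SuperPartition) (c : ℕ) :
    Λ.conj.conj.colLength c = Λ.colLength c := by
  rw [colLength_conj, star_conj]

theorem mem_anti_iff (Λ : SuperPartition) (c : ℕ) : c ∈ Λ.anti ↔ ∃ r, (r, c) ∈ Λ.circles := by
  simp only [mem_circles]
  exact ⟨fun h => ⟨_, h, rfl⟩, fun ⟨_, h, _⟩ => h⟩

theorem conj_conj (Λ : SuperPartition) : Λ.conj.conj = Λ := by
  refine eq_of_mem_anti_iff (fun a => ?_) Λ.colLength_conj_conj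
  simp only [mem_anti_iff, circles_conj]

theorem fermionicDegree_conj (Λ : SuperPartition) :
    Λ.conj.fermionicDegree = Λ.fermionicDegree := by
  simp [fermionicDegree, conj]

theorem length_star (Λ : SuperPartition) : Λ.star.length = Λ.length := by
  rw [star, (compSort_perm _).length_eq, comp, List.length_append, length]

theorem length_comp (Λ : SuperPartition) : Λ.comp.length = Λ.length := by
  rw [comp, List.length_append, length]

theorem sum_star (Λ : SuperPartition) : Λ.star.sum = Λ.degree := (compSort_perm _).sum_eq

theorem degree_conj (Λ : SuperPartition) : Λ.conj.degree = Λ.degree := by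
  set M := max (Λ.conj.comp.foldr max 0) Λ.length
  rw [degree, sum_eq_sum_countP_lt (M := M) _ fun p hp => (le_foldr_max hp).trans (le_max_left _ _),
    ← sum_star, sum_eq_sum_compSeq (N := M) _ (Λ.length_star.trans_le (le_max_right _ _))]
  exact Finset.sum_congr rfl fun r _ => Λ.colLength_conj r

/-- Transposition exchanges the two coordinates of a circle, so the decreasing fermionic parts of
`Λ'` sit in the rows numbered by the increasing fermionic parts of `Λ`. -/
theorem anti_conj_getElem (Λ : SuperPartition) (k : ℕ) (hk : k < Λ.conj.anti.length) :
    Λ.conj.colLength Λ.conj.anti[k] = Λ.anti.reverse[k]'(by simpa [conj] using hk) := by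
  have hk' : k < Λ.anti.reverse.length := by simpa [conj] using hk
  set a := Λ.anti.reverse[k]
  have ha : a ∈ Λ.anti := List.mem_reverse.1 (List.getElem_mem hk')
  have h1 : (Λ.colLength a, a) ∈ Λ.circles := (Λ.mem_circles _ _).2 ⟨ha, rfl⟩
  have h2 := (Λ.conj.mem_circles _ _).1 ((Λ.circles_conj _ _).2 h1)
  have : Λ.conj.anti[k] = Λ.colLength a := by simp [conj, a]
  rw [this, ← h2.2]

/-- The rows of `Λ'` are the columns of `D[Λ]`, circled or not, and here they have distinct indices
below `N`. This keeps `m_{Λ'}` nonzero in `N` pairs of variables when `e_Λ` involves only the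
generators available there. -/
theorem length_conj_le (Λ : SuperPartition) {N : ℕ} (ha : ∀ a ∈ Λ.anti, a < N)
    (hs : ∀ p ∈ Λ.sym, p ≤ N) : Λ.conj.length ≤ N := by
  have hM : Λ.comp.foldr max 0 ≤ N := by
    have : ∀ l : List ℕ, (∀ p ∈ l, p ≤ N) → l.foldr max 0 ≤ N := by
      intro l
      induction l with
      | nil => simp
      | cons a l ih => intro h; simp at h ⊢; exact ⟨h.1, ih h.2⟩
    refine this _ fun p hp => ?_
    rcases List.mem_append.1 hp with hp | hp
    · exact (ha p hp).le
    · exact hs p hp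
  have hnd : (Λ.anti ++ (List.range (Λ.comp.foldr max 0)).filter
      (fun c => decide (c ∉ Λ.anti))).Nodup := by
    refine List.Nodup.append Λ.anti_nodup (List.nodup_range.filter _) fun a ha hb => ?_
    simp [ha] at hb
  have hsub : (Λ.anti ++ (List.range (Λ.comp.foldr max 0)).filter
      (fun c => decide (c ∉ Λ.anti))) ⊆ List.range N := by
    intro c hc
    rcases List.mem_append.1 hc with hc | hc
    · exact List.mem_range.2 (ha c hc)
    · simp only [List.mem_filter, List.mem_range] at hc ⊢
      omega
  have := (List.subperm_of_subset hnd hsub).length_le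
  simpa [length, conj] using this

/-- Parts of `sym` are positive and so are counted by the degree; fermionic parts are counted
separately. Hence `n + m` pairs of variables suffice to see every superpartition of `(n|m)`. -/
theorem length_le (Λ : SuperPartition) : Λ.length ≤ Λ.degree + Λ.fermionicDegree := by
  have : ∀ l : List ℕ, (∀ p ∈ l, 0 < p) → l.length ≤ l.sum := by
    intro l
    induction l with
    | nil => simp
    | cons a l ih =>
      intro h
      simp only [List.mem_cons, forall_eq_or_imp] at h
      have := ih h.2
      simp; omega
  have := this _ Λ.sym_pos
  simp only [length, degree, fermionicDegree, comp, List.sum_append]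
  omega

/-- Mutual position of superpartitions in the monomial expansion of products of elementary
functions. -/
def Below (Ω Λ : SuperPartition) : Prop :=
  dominanceLT Ω.star Λ.star ∨
    compSeq Ω.star = compSeq Λ.star ∧ Ω.fermionicDegree = Λ.fermionicDegree ∧ Ω ≠ Λ ∧
      ∀ k, compSeq Ω.anti k ≤ compSeq Λ.anti k

theorem colLength_eq_of_star_eq {Ω Λ : SuperPartition} (h : compSeq Ω.star = compSeq Λ.star)
    (c : ℕ) : Ω.colLength c = Λ.colLength c := by
  refine eq_of_forall_lt_iff fun r => ?_
  rw [← lt_star_iff, ← lt_star_iff, h]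

/-- The fermionic degree has to be compared separately, since `compSeq` cannot see a final part `0`
of `anti`. -/
theorem eq_of_star_eq {Ω Λ : SuperPartition} (h : compSeq Ω.star = compSeq Λ.star)
    (hf : Ω.fermionicDegree = Λ.fermionicDegree) (ha : compSeq Ω.anti = compSeq Λ.anti) :
    Ω = Λ := by
  refine eq_of_colLength_eq (List.ext_getElem hf fun i h₁ h₂ => ?_) (colLength_eq_of_star_eq h)
  have := congrFun ha i
  rwa [compSeq, compSeq, List.getD_eq_getElem _ _ h₁, List.getD_eq_getElem _ _ h₂] at this

theorem Below.irrefl (Λ : SuperPartition) : ¬ Below Λ Λ := by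
  rintro (h | h)
  · exact h.2.2 rfl
  · exact h.2.2.1 rfl

theorem Below.trans {Λ Ω Γ : SuperPartition} (h : Below Λ Ω) (h' : Below Ω Γ) : Below Λ Γ := by
  rcases h with h | h <;> rcases h' with h' | h'
  · refine Or.inl ⟨h.1.trans h'.1, fun k => (h.2.1 k).trans (h'.2.1 k), fun he => h.2.2 ?_⟩
    -- If the two ends agreed, all partial sums would be squeezed together, and their consecutive
    -- differences would identify the first two sequences.
    have key : ∀ k, ∑ i ∈ Finset.range k, compSeq Λ.star i =
        ∑ i ∈ Finset.range k, compSeq Ω.star i := fun k =>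
      (h.2.1 k).antisymm (by rw [he]; exact h'.2.1 k)
    funext k
    have h1 := key (k + 1)
    rw [Finset.sum_range_succ, Finset.sum_range_succ, key k] at h1
    omega
  · refine Or.inl ⟨h.1.trans ?_, ?_, ?_⟩
    · rw [sum_eq_sum_compSeq Ω.star (le_max_left _ Γ.star.length),
        sum_eq_sum_compSeq Γ.star (le_max_right Ω.star.length _), h'.1]
    · rw [← h'.1]; exact h.2.1
    · rw [← h'.1]; exact h.2.2
  · refine Or.inl ⟨Eq.trans ?_ h'.1, ?_, ?_⟩
    · rw [sum_eq_sum_compSeq Λ.star (le_max_left _ Ω.star.length),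
        sum_eq_sum_compSeq Ω.star (le_max_right Λ.star.length _), h.1]
    · rw [h.1]; exact h'.2.1
    · rw [h.1]; exact h'.2.2
  · refine Or.inr ⟨h.1.trans h'.1, h.2.1.trans h'.2.1, ?_, fun k => (h.2.2.2 k).trans (h'.2.2.2 k)⟩
    rintro rfl
    exact h.2.2.1 (eq_of_star_eq h.1 h.2.1 (funext fun k => (h.2.2.2 k).antisymm (h'.2.2.2 k)))

end SuperPartition

/-! ### Finiteness of the set of superpartitions of `(n|m)` -/

theorem SPar.conj_mem {n m : ℕ} (Λ : SPar n m) :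
    Λ.1.conj.degree = n ∧ Λ.1.conj.fermionicDegree = m :=
  ⟨Λ.1.degree_conj.trans Λ.2.1, Λ.1.fermionicDegree_conj.trans Λ.2.2⟩

theorem SPar.length_le {n m : ℕ} (Λ : SPar n m) : Λ.1.length ≤ n + m := by
  have := Λ.1.length_le
  rwa [Λ.2.1, Λ.2.2] at this

theorem finite_boundedLists (n k : ℕ) : {l : List ℕ | l.length ≤ k ∧ ∀ p ∈ l, p ≤ n}.Finite := by
  refine ((List.finite_length_le (Fin (n + 1)) k).image (List.map Fin.val)).subset ?_
  rintro l ⟨hl, hn⟩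
  refine ⟨l.pmap (fun p hp => ⟨p, Nat.lt_succ_of_le hp⟩) hn, by simpa using hl, ?_⟩
  simp [List.map_pmap]

instance (n m : ℕ) : Finite (SPar n m) := by
  have hfin := finite_boundedLists n (n + m)
  refine Finite.of_injective (β := hfin.toFinset × hfin.toFinset)
    (fun Λ => (⟨Λ.1.anti, ?_⟩, ⟨Λ.1.sym, ?_⟩)) fun Λ Ω h => ?_
  · have h1 := Λ.length_le
    have h2 := fun p (hp : p ∈ Λ.1.comp) => List.le_sum_of_mem hp
    rw [Set.Finite.mem_toFinset]
    refine ⟨(Nat.le_add_right _ _).trans h1, fun p hp => ?_⟩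
    exact (h2 p (List.mem_append_left _ hp)).trans_eq Λ.2.1
  · have h1 := Λ.length_le
    have h2 := fun p (hp : p ∈ Λ.1.comp) => List.le_sum_of_mem hp
    rw [Set.Finite.mem_toFinset]
    refine ⟨(Nat.le_add_left _ _).trans h1, fun p hp => ?_⟩
    exact (h2 p (List.mem_append_right _ hp)).trans_eq Λ.2.1
  · simp only [Prod.mk.injEq, Subtype.mk.injEq] at h
    exact Subtype.ext (SuperPartition.ext h.1 h.2)

/-! ### Fillings of the columns of a diagram -/

/-- Double counting of the pairs (letter, column) with the letter below `k` and in the column. -/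
theorem Finset.sum_range_card_fiber {C : Type*} [Fintype C] (J : C → Finset ℕ) (k : ℕ) :
    ∑ i ∈ Finset.range k, (Finset.univ.filter fun c => i ∈ J c).card =
      ∑ c, (J c ∩ Finset.range k).card := by
  simp only [Finset.card_filter]
  rw [Finset.sum_comm]
  refine Finset.sum_congr rfl fun c _ => ?_
  rw [Finset.inter_comm, ← Finset.filter_mem_eq_inter, Finset.card_filter]

theorem card_inter_range_le (J : Finset ℕ) (k : ℕ) :
    (J ∩ Finset.range k).card ≤ (Finset.range J.card ∩ Finset.range k).card := by
  have h1 : (J ∩ Finset.range k).card ≤ J.card := Finset.card_le_card Finset.inter_subset_left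
  have h2 : (J ∩ Finset.range k).card ≤ k :=
    (Finset.card_le_card Finset.inter_subset_right).trans (by simp)
  have h3 : Finset.range J.card ∩ Finset.range k = Finset.range (min J.card k) := by
    ext; simp
  rw [h3, Finset.card_range]
  exact le_min h1 h2

/-- In a filling of columns, the content is dominated by the row lengths. -/
theorem sum_content_le {C : Type*} [Fintype C] (J : C → Finset ℕ) (k : ℕ) :
    ∑ i ∈ Finset.range k, (Finset.univ.filter fun c => i ∈ J c).card ≤
      ∑ i ∈ Finset.range k, (Finset.univ.filter fun c => i < (J c).card).card := by
  have h := Finset.sum_range_card_fiber (fun c => Finset.range (J c).card) k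
  simp only [Finset.mem_range] at h
  rw [Finset.sum_range_card_fiber, h]
  exact Finset.sum_le_sum fun c _ => card_inter_range_le _ _

/-- A filling of columns whose content equals the row lengths is the standard one. -/
theorem filling_eq_range {C : Type*} [Fintype C] (J : C → Finset ℕ)
    (h : ∀ i, (Finset.univ.filter fun c => i ∈ J c).card =
      (Finset.univ.filter fun c => i < (J c).card).card) (c : C) :
    J c = Finset.range (J c).card := by
  have hk : (J c ∩ Finset.range (J c).card).card = (J c).card := by
    -- The total over all columns attains its upper bound, so every column does. The cut-off `k = (J
    -- c).card` is the one at which this forces all of `J c` below `k`.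
    set k := (J c).card with hkdef
    have h' := Finset.sum_range_card_fiber (fun c => Finset.range (J c).card) k
    simp only [Finset.mem_range] at h'
    rw [← Finset.sum_congr rfl fun i _ => h i, Finset.sum_range_card_fiber] at h'
    have := (Finset.sum_eq_sum_iff_of_le fun c _ => card_inter_range_le (J c) k).1 h' c
      (Finset.mem_univ c)
    rw [this]; simp [hkdef]
  have hsub : J c ⊆ Finset.range (J c).card :=
    Finset.inter_eq_left.1 (Finset.eq_of_subset_of_card_le Finset.inter_subset_left hk.ge)
  exact Finset.eq_of_subset_of_card_le hsub (by simp)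

/-! ### Reduced words -/

/-- Insertion into a sorted list places `a` directly after the strictly larger entries, hence
leftmost among its equals. This is the row in which the diagram puts the circle. -/
theorem compSeq_compSort_cons (a : ℕ) (l : List ℕ) (i : ℕ) :
    compSeq (compSort (a :: l)) i =
      if i < l.countP (fun p => decide (a < p)) then compSeq (compSort l) i
      else if i = l.countP (fun p => decide (a < p)) then a else compSeq (compSort l) (i - 1) := by
  have hmono : ∀ c d, c ≤ d → l.countP (fun p => decide (d < p)) ≤
      l.countP (fun p => decide (c < p)) := fun c d h => by
    apply List.countP_mono_left
    intro x _ hx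
    simp only [decide_eq_true_eq] at hx ⊢
    omega
  refine eq_of_forall_lt_iff fun c => ?_
  have key : ∀ (l : List ℕ) r, c < compSeq (compSort l) r ↔ r < l.countP (fun p => decide (c < p)) :=
    fun l r => by rw [lt_compSeq_iff (compSort_sorted l), (compSort_perm l).countP_eq]
  rw [key, List.countP_cons]
  simp only [decide_eq_true_eq]
  by_cases hca : c < a
  · have := hmono c a hca.le
    simp only [hca, if_true]
    split_ifs
    · rw [key]; omega
    · simp only [hca, iff_true]; omega
    · rw [key]; omega
  · have := hmono a c (not_lt.1 hca)
    simp only [hca, if_false]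
    split_ifs
    · rw [key]; omega
    · simp only [hca, iff_false]; omega
    · rw [key]; omega

theorem wordPerm_append (u v : List ℕ) : wordPerm (u ++ v) = wordPerm u * wordPerm v := by
  simp [wordPerm]

theorem wordPerm_map_succ_zero (u : List ℕ) : wordPerm (u.map (· + 1)) 0 = 0 := by
  induction u with
  | nil => rfl
  | cons i u ih =>
    have h : wordPerm ((i :: u).map (· + 1)) 0 =
      Equiv.swap (i + 1) (i + 1 + 1) (wordPerm (u.map (· + 1)) 0) := rfl
    rw [h, ih, Equiv.swap_apply_of_ne_of_ne] <;> omega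

theorem wordPerm_map_succ_succ (u : List ℕ) (k : ℕ) :
    wordPerm (u.map (· + 1)) (k + 1) = wordPerm u k + 1 := by
  induction u with
  | nil => rfl
  | cons i u ih =>
    have h : wordPerm ((i :: u).map (· + 1)) (k + 1) =
      Equiv.swap (i + 1) (i + 1 + 1) (wordPerm (u.map (· + 1)) (k + 1)) := rfl
    have h' : wordPerm (i :: u) k = Equiv.swap i (i + 1) (wordPerm u k) := rfl
    rw [h, ih, h']
    simp only [Equiv.swap_apply_def]
    split_ifs <;> omega

/-- The word `0, 1, …, p - 1` is the cycle bringing position `p` to the front, which undoes an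
insertion at position `p`. -/
theorem wordPerm_range (p i : ℕ) :
    wordPerm (List.range p) i = if i < p then i + 1 else if i = p then 0 else i := by
  induction p generalizing i with
  | zero =>
    simp only [List.range_zero, wordPerm, List.map_nil, List.prod_nil, Equiv.Perm.one_apply]
    split_ifs <;> omega
  | succ p ih =>
    have h : wordPerm (List.range (p + 1)) i =
        wordPerm (List.range p) (Equiv.swap p (p + 1) i) := by
      rw [List.range_succ, wordPerm_append]; rfl
    rw [h, ih]
    simp only [Equiv.swap_apply_def]
    split_ifs <;> omega

/-- A reduced word of the permutation sorting the composition `A ++ s`, where `A` is strictly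
decreasing and `s` non-increasing. -/
def sortingWord : List ℕ → List ℕ → List ℕ
  | [], _ => []
  | a :: A, s => (sortingWord A s).map (· + 1) ++ List.range (s.countP fun p => decide (a < p))

theorem countP_lt_cons {a : ℕ} {A : List ℕ} (h : ∀ b ∈ A, b < a) (s : List ℕ) :
    (A ++ s).countP (fun p => decide (a < p)) = s.countP (fun p => decide (a < p)) := by
  rw [List.countP_append, List.countP_eq_zero.2, zero_add]
  intro b hb
  have := h b hb
  simp only [decide_eq_true_eq]
  omega

/-- The shifted word fixes position `0` and sorts the tail; the final cycle accounts for the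
insertion of `a`. As `A` decreases strictly, all tail entries larger than `a` lie in `s`, so the
count used in `sortingWord` is the insertion position. -/
theorem wordSorts_sortingWord {A s : List ℕ} (hA : A.Pairwise (· > ·))
    (hs : s.Pairwise (· ≥ ·)) : WordSorts (sortingWord A s) (A ++ s) := by
  induction A with
  | nil =>
    intro i
    have : compSort s = s := by
      refine List.Perm.eq_of_pairwise (le := (· ≥ ·)) ?_ (compSort_sorted s) hs (compSort_perm s)
      intro a b _ _ h h'
      exact le_antisymm h' h
    simp [sortingWord, wordPerm, this]
  | cons a A ih =>
    rw [List.pairwise_cons] at hA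
    have ih := ih hA.2
    intro i
    rw [List.cons_append, compSeq_compSort_cons, sortingWord, wordPerm_append,
      countP_lt_cons hA.1, Equiv.Perm.mul_apply, wordPerm_range]
    have hsucc : ∀ j, compSeq (a :: (A ++ s)) (j + 1) = compSeq (A ++ s) j := fun j => rfl
    split_ifs with h1 h2
    · rw [wordPerm_map_succ_succ, hsucc, ih]
    · rw [wordPerm_map_succ_zero]; rfl
    · obtain ⟨j, rfl⟩ : ∃ j, i = j + 1 := ⟨i - 1, by omega⟩
      rw [wordPerm_map_succ_succ, hsucc, ih, Nat.add_sub_cancel]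

theorem countP_lt_getElem {A : List ℕ} (s : List ℕ) (hA : A.Pairwise (· > ·)) (k : ℕ)
    (hk : k < A.length) :
    (A ++ s).countP (fun p => decide (A[k] < p)) = k + s.countP (fun p => decide (A[k] < p)) := by
  induction A generalizing k with
  | nil => simp at hk
  | cons a A ih =>
    rw [List.pairwise_cons] at hA
    cases k with
    | zero => simp [countP_lt_cons hA.1]
    | succ k =>
      have hk' : k < A.length := by simpa using hk
      have h := ih hA.2 k hk'
      have hlt := hA.1 A[k] (List.getElem_mem _)
      simp only [List.cons_append, List.getElem_cons_succ, List.countP_cons, h]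
      simp [hlt]; omega

/-- Among equal entries of the sorted composition, the leftmost is matched with the fermionic part.
Thus the circles of the diagram correspond to the first indices, those carrying a `θ` in the leading
monomial. -/
theorem wordPerm_sortingWord {A : List ℕ} (s : List ℕ) (hA : A.Pairwise (· > ·)) (k : ℕ)
    (hk : k < A.length) :
    wordPerm (sortingWord A s) (k + s.countP (fun p => decide (A[k] < p))) = k := by
  induction A generalizing k with
  | nil => simp at hk
  | cons a A ih =>
    rw [List.pairwise_cons] at hA
    rw [sortingWord, wordPerm_append, Equiv.Perm.mul_apply, wordPerm_range]
    cases k with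
    | zero => simp [wordPerm_map_succ_zero]
    | succ k =>
      have hk' : k < A.length := by simpa using hk
      have h := ih hA.2 k hk'
      have hlt := hA.1 A[k] (List.getElem_mem _)
      have hle : s.countP (fun p => decide (a < p)) ≤ s.countP (fun p => decide (A[k] < p)) := by
        apply List.countP_mono_left
        intro x _ hx
        simp only [decide_eq_true_eq] at hx ⊢
        omega
      simp only [List.getElem_cons_succ]
      rw [if_neg (by omega), if_neg (by omega), show ∀ x, k + 1 + x = k + x + 1 by omega,
        wordPerm_map_succ_succ, h]

/-- A simple transposition raises at most one element of a finite set, and by one only. This yields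
the lower bound on the length of a sorting word. -/
theorem sum_wordPerm_symm_le (v : List ℕ) (A : Finset ℕ) :
    ∑ k ∈ A, (wordPerm v).symm k ≤ ∑ k ∈ A, k + v.length := by
  induction v generalizing A with
  | nil => exact le_rfl
  | cons i v ih =>
    have h : ∀ k, (wordPerm (i :: v)).symm k = (wordPerm v).symm (Equiv.swap i (i + 1) k) := by
      intro k
      rw [Equiv.symm_apply_eq]
      have : wordPerm (i :: v) = Equiv.swap i (i + 1) * wordPerm v := rfl
      simp [this]
    have h1 := ih (A.map (Equiv.swap i (i + 1)).toEmbedding)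
    simp only [Finset.sum_map, Equiv.coe_toEmbedding] at h1
    have h2 : ∑ k ∈ A, Equiv.swap i (i + 1) k ≤ ∑ k ∈ A, k + 1 := by
      calc ∑ k ∈ A, Equiv.swap i (i + 1) k ≤ ∑ k ∈ A, (k + if k = i then 1 else 0) := by
            refine Finset.sum_le_sum fun k _ => ?_
            rw [Equiv.swap_apply_def]
            split_ifs <;> omega
        _ ≤ ∑ k ∈ A, k + 1 := by
            rw [Finset.sum_add_distrib, Finset.sum_ite_eq']
            split_ifs <;> omega
    simp only [h, List.length_cons]
    omega

theorem length_sortingWord (A s : List ℕ) :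
    (sortingWord A s).length =
      ∑ k : Fin A.length, s.countP (fun p => decide (A[k] < p)) := by
  induction A with
  | nil => rfl
  | cons a A ih =>
    rw [sortingWord, List.length_append, List.length_map, List.length_range, ih]
    simp only [List.length_cons, Fin.sum_univ_succ, add_comm]
    rfl

/-- For any sorting word, the preimage of `k` is a position of the sorted list holding `A[k]`, hence
at least the number of strictly larger entries. Summing over the positions of `A`,
`sum_wordPerm_symm_le` bounds the word length below by the length of `sortingWord`. -/
theorem isMinimalWord_sortingWord {A s : List ℕ} (hA : A.Pairwise (· > ·))
    (hs : s.Pairwise (· ≥ ·)) : IsMinimalWord (sortingWord A s) (A ++ s) := by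
  refine ⟨wordSorts_sortingWord hA hs, fun v hv => ?_⟩
  have h1 := sum_wordPerm_symm_le v (Finset.range A.length)
  rw [← Fin.sum_univ_eq_sum_range, ← Fin.sum_univ_eq_sum_range (fun i => i)] at h1
  have h2 : ∀ k : Fin A.length, (k : ℕ) + s.countP (fun p => decide (A[k] < p)) ≤
      (wordPerm v).symm k := fun k => by
    rw [Fin.getElem_fin, ← countP_lt_getElem s hA k k.2, ← not_lt,
      ← (compSort_perm (A ++ s)).countP_eq, ← lt_compSeq_iff (compSort_sorted _), ← hv,
      Equiv.apply_symm_apply, compSeq, List.getD_eq_getElem _ _ (by simp; omega),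
      List.getElem_append_left k.2]
    exact lt_irrefl _
  have h3 := Finset.sum_le_sum fun k (_ : k ∈ Finset.univ) => h2 k
  rw [Finset.sum_add_distrib, ← length_sortingWord] at h3
  omega

/-- Both words are built from blocks that are shifted initial segments, with equal shifts in
matching blocks, so comparing block lengths is enough. -/
theorem sortingWord_sublist {A B s t : List ℕ} (hAB : A.length = B.length)
    (h : ∀ (k : ℕ) (hk : k < A.length), s.countP (fun p => decide (A[k] < p)) ≤
      t.countP (fun p => decide (B[k] < p))) :
    (sortingWord A s).Sublist (sortingWord B t) := by
  induction A generalizing B with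
  | nil => exact List.nil_sublist _
  | cons a A ih =>
    cases B with
    | nil => simp at hAB
    | cons b B =>
      refine List.Sublist.append ((ih (by simpa using hAB) fun k hk => ?_).map _) ?_
      · exact h (k + 1) (by simpa using hk)
      · exact List.range_sublist.2 (h 0 (by simp))

namespace SuperPartition

theorem colLength_anti_getElem (Λ : SuperPartition) (k : ℕ) (hk : k < Λ.anti.length) :
    Λ.colLength Λ.anti[k] = k + Λ.sym.countP (fun p => decide (Λ.anti[k] < p)) :=
  countP_lt_getElem Λ.sym Λ.anti_sorted k hk

/-- A permutation sorting the parts of a superpartition, stable on equal parts. -/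
theorem exists_sorting_perm (Λ : SuperPartition) : ∃ σ : Equiv.Perm ℕ,
    (∀ i, compSeq Λ.comp (σ i) = compSeq Λ.star i) ∧
      ∀ (k : ℕ) (hk : k < Λ.anti.length), σ (Λ.colLength Λ.anti[k]) = k :=
  ⟨wordPerm (sortingWord Λ.anti Λ.sym), wordSorts_sortingWord Λ.anti_sorted Λ.sym_sorted,
    fun k hk => by
      rw [colLength_anti_getElem]; exact wordPerm_sortingWord Λ.sym Λ.anti_sorted k hk⟩

/-- When the stars agree, so do all column lengths, and a smaller fermionic part sits at the end of
a longer column. Removing the `k` larger fermionic parts from both counts compares the blocks of the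
two reduced words. -/
theorem Below.bruhatLT {Ω Λ : SuperPartition} (h : Below Ω Λ) : Ω.BruhatLT Λ := by
  refine ⟨?_, fun he => Below.irrefl Λ (he ▸ h)⟩
  rcases h with h | ⟨hst, hf, -, ha⟩
  · exact Or.inl h
  · refine Or.inr ⟨hst, _, _, isMinimalWord_sortingWord Λ.anti_sorted Λ.sym_sorted,
      isMinimalWord_sortingWord Ω.anti_sorted Ω.sym_sorted, ?_⟩
    refine sortingWord_sublist hf.symm fun k hk => ?_
    have hk' : k < Ω.anti.length := hk.trans_eq hf.symm
    have h1 := ha k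
    rw [compSeq, compSeq, List.getD_eq_getElem _ _ hk, List.getD_eq_getElem _ _ hk'] at h1
    have h2 := Ω.colLength_anti h1
    rw [Ω.colLength_anti_getElem, colLength_eq_of_star_eq hst, Λ.colLength_anti_getElem] at h2
    omega

end SuperPartition

/-! ### Monomials and coefficients of superpolynomials -/

noncomputable section

namespace SuperPoly

variable {N : ℕ}

/-- The monomial `x^μ θ_{j 0} ⋯ θ_{j (k-1)}`. -/
def monom {k : ℕ} (μ : Fin N →₀ ℕ) (j : Fin k → Fin N) : SuperPoly N :=
  MvPolynomial.monomial μ 1 ⊗ₜ ExteriorAlgebra.ιMulti ℤ k fun a => Pi.single (j a) 1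

theorem list_ofFn_θ {k : ℕ} (j : Fin k → Fin N) :
    (List.ofFn fun a => θ (j a)).prod =
      (1 ⊗ₜ ExteriorAlgebra.ιMulti ℤ k fun a => Pi.single (j a) 1 : SuperPoly N) := by
  have h := map_list_prod (Algebra.TensorProduct.includeRight (R := ℤ)
    (A := MvPolynomial (Fin N) ℤ) (B := ExteriorAlgebra ℤ (Fin N → ℤ)))
    (List.ofFn fun a => ExteriorAlgebra.ι ℤ (Pi.single (j a) 1))
  rw [List.map_ofFn] at h
  rw [ExteriorAlgebra.ιMulti_apply]
  exact h.symm

theorem ofPoly_mul_list_ofFn_θ {k : ℕ} (p : MvPolynomial (Fin N) ℤ) (j : Fin k → Fin N) :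
    ofPoly p * (List.ofFn fun a => θ (j a)).prod =
      p ⊗ₜ ExteriorAlgebra.ιMulti ℤ k fun a => Pi.single (j a) 1 := by
  rw [list_ofFn_θ, ofPoly, Algebra.TensorProduct.tmul_mul_tmul, one_mul, mul_one]

theorem list_ofFn_θ_mul_ofPoly {k : ℕ} (p : MvPolynomial (Fin N) ℤ) (j : Fin k → Fin N) :
    (List.ofFn fun a => θ (j a)).prod * ofPoly p =
      p ⊗ₜ ExteriorAlgebra.ιMulti ℤ k fun a => Pi.single (j a) 1 := by
  rw [list_ofFn_θ, ofPoly, Algebra.TensorProduct.tmul_mul_tmul, one_mul, mul_one]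

theorem monom_mem_homogeneous {k : ℕ} (μ : Fin N →₀ ℕ) (j : Fin k → Fin N) :
    monom μ j ∈ homogeneous N μ.degree k :=
  Submodule.subset_span ⟨μ, j, rfl, (ofPoly_mul_list_ofFn_θ _ _).symm⟩

/-- The basis of the superpolynomials consisting of the monomials `x^μ θ_S`. -/
def monomBasis (N : ℕ) :=
  (MvPolynomial.basisMonomials (Fin N) ℤ).tensorProduct (Pi.basisFun ℤ (Fin N)).ExteriorAlgebra

theorem monomBasis_apply {k : ℕ} (μ : Fin N →₀ ℕ) (S : Finset (Fin N)) (hS : S.card = k) :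
    monomBasis N (μ, S) = monom μ (S.orderEmbOfFin hS) := by
  rw [monomBasis, Module.Basis.tensorProduct_apply, MvPolynomial.coe_basisMonomials,
    ExteriorAlgebra.basis_apply_ofCard _ hS, monom]
  congr 1
  rw [ExteriorAlgebra.ιMulti_family]
  congr 1
  funext a
  simp [Set.powersetCard.ofFinEmbEquiv_symm_apply]

/-- Linearity over `ℤ` is automatic, so additive maps are determined by the monomial basis. -/
theorem addMonoidHom_ext_monom {M : Type*} [AddCommGroup M] {f g : SuperPoly N →+ M}
    (h : ∀ (k : ℕ) (μ : Fin N →₀ ℕ) (j : Fin k → Fin N), f (monom μ j) = g (monom μ j)) :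
    f = g := by
  let F (f : SuperPoly N →+ M) : MvPolynomial (Fin N) ℤ ⊗[ℤ] ExteriorAlgebra ℤ (Fin N → ℤ) →ₗ[ℤ] M :=
    { f with map_smul' := fun c x => map_intCast_smul f ℤ ℤ c x }
  have hFG : F f = F g := (monomBasis N).ext fun ⟨μ, S⟩ => by
    rw [monomBasis_apply μ S rfl]
    exact h _ _ _
  exact AddMonoidHom.ext fun x => LinearMap.congr_fun hFG x

/-- The quotient map by `H` vanishes on monomials, hence everywhere. -/
theorem mem_of_monom_mem (H : AddSubgroup (SuperPoly N))
    (h : ∀ (k : ℕ) (μ : Fin N →₀ ℕ) (j : Fin k → Fin N), monom μ j ∈ H) (f : SuperPoly N) :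
    f ∈ H := by
  have hH : QuotientAddGroup.mk' H = 0 := addMonoidHom_ext_monom fun k μ j =>
    (QuotientAddGroup.eq_zero_iff _).2 (h k μ j)
  exact (QuotientAddGroup.eq_zero_iff f).1 (DFunLike.congr_fun hH f)

/-- The coefficient of `θ_{j 0} ⋯ θ_{j (k-1)}` in an element of the Grassmann algebra. -/
def thetaCoeff {k : ℕ} (j : Fin k → Fin N) : ExteriorAlgebra ℤ (Fin N → ℤ) →ₗ[ℤ] ℤ :=
  ExteriorAlgebra.liftAlternating
    (Pi.single k (Matrix.detRowAlternating.compLinearMap (LinearMap.funLeft ℤ ℤ j)))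

theorem thetaCoeff_ιMulti {k : ℕ} (j : Fin k → Fin N) (v : Fin k → Fin N → ℤ) :
    thetaCoeff j (ExteriorAlgebra.ιMulti ℤ k v) = Matrix.det (Matrix.of fun a b => v a (j b)) := by
  rw [thetaCoeff, ExteriorAlgebra.liftAlternating_apply_ιMulti, Pi.single_eq_same]
  rfl

theorem thetaCoeff_ιMulti_of_ne {k l : ℕ} (h : l ≠ k) (j : Fin k → Fin N)
    (v : Fin l → Fin N → ℤ) : thetaCoeff j (ExteriorAlgebra.ιMulti ℤ l v) = 0 := by
  rw [thetaCoeff, ExteriorAlgebra.liftAlternating_apply_ιMulti, Pi.single_eq_of_ne h]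
  rfl

/-- Precomposing vectors with `g` changes the minor at columns `j` into the minor at columns `g ∘
j`. This serves both permutations and the restriction to fewer variables. -/
theorem thetaCoeff_map {N' k : ℕ} (g : Fin N' → Fin N) (j : Fin k → Fin N')
    (y : ExteriorAlgebra ℤ (Fin N → ℤ)) :
    thetaCoeff j (ExteriorAlgebra.map (LinearMap.funLeft ℤ ℤ g) y) = thetaCoeff (g ∘ j) y := by
  suffices h : (thetaCoeff j).comp (ExteriorAlgebra.map (LinearMap.funLeft ℤ ℤ g)).toLinearMap =
      thetaCoeff (g ∘ j) from LinearMap.congr_fun h y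
  refine ExteriorAlgebra.lhom_ext fun l => AlternatingMap.ext fun v => ?_
  simp only [LinearMap.compAlternatingMap_apply, LinearMap.comp_apply, AlgHom.toLinearMap_apply,
    ExteriorAlgebra.map_apply_ιMulti]
  by_cases h : l = k
  · subst h
    rw [thetaCoeff_ιMulti, thetaCoeff_ιMulti]
    rfl
  · rw [thetaCoeff_ιMulti_of_ne h, thetaCoeff_ιMulti_of_ne h]

theorem thetaCoeff_comp_perm {k : ℕ} (j : Fin k → Fin N) (τ : Equiv.Perm (Fin k))
    (y : ExteriorAlgebra ℤ (Fin N → ℤ)) :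
    thetaCoeff (j ∘ τ) y = (Equiv.Perm.sign τ : ℤ) * thetaCoeff j y := by
  suffices h : thetaCoeff (j ∘ τ) = (Equiv.Perm.sign τ : ℤ) • thetaCoeff j from
    LinearMap.congr_fun h y
  refine ExteriorAlgebra.lhom_ext fun l => AlternatingMap.ext fun v => ?_
  simp only [LinearMap.compAlternatingMap_apply, LinearMap.smul_apply]
  by_cases h : l = k
  · subst h
    rw [thetaCoeff_ιMulti, thetaCoeff_ιMulti, smul_eq_mul]
    exact Matrix.det_permute' τ (Matrix.of fun a b => v a (j b))
  · rw [thetaCoeff_ιMulti_of_ne h, thetaCoeff_ιMulti_of_ne h, smul_zero]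

/-- The coefficient of `x^μ θ_{j 0} ⋯ θ_{j (k-1)}` in a superpolynomial. -/
def coeff {k : ℕ} (μ : Fin N →₀ ℕ) (j : Fin k → Fin N) : SuperPoly N →+ ℤ :=
  (TensorProduct.lift ((LinearMap.mul ℤ ℤ).compl₁₂ (MvPolynomial.lcoeff ℤ μ)
    (thetaCoeff j))).toAddMonoidHom

theorem coeff_tmul {k : ℕ} (μ : Fin N →₀ ℕ) (j : Fin k → Fin N) (p : MvPolynomial (Fin N) ℤ)
    (y : ExteriorAlgebra ℤ (Fin N → ℤ)) :
    coeff μ j (p ⊗ₜ y) = p.coeff μ * thetaCoeff j y := rfl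

theorem coeff_monom {k : ℕ} (μ ν : Fin N →₀ ℕ) (j i : Fin k → Fin N) :
    coeff μ j (monom ν i) = if ν = μ then
      Matrix.det (Matrix.of fun a b => if i a = j b then (1 : ℤ) else 0) else 0 := by
  rw [monom, coeff_tmul, MvPolynomial.coeff_monomial, thetaCoeff_ιMulti, ite_mul, one_mul,
    zero_mul]
  simp only [Pi.single_apply, eq_comm]

theorem coeff_monom_of_ne {k l : ℕ} (h : l ≠ k) (μ ν : Fin N →₀ ℕ) (j : Fin k → Fin N)
    (i : Fin l → Fin N) : coeff μ j (monom ν i) = 0 := by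
  rw [monom, coeff_tmul, thetaCoeff_ιMulti_of_ne h, mul_zero]

theorem coeff_monom_self {k : ℕ} (μ : Fin N →₀ ℕ) {j : Fin k → Fin N}
    (hj : Function.Injective j) : coeff μ j (monom μ j) = 1 := by
  rw [coeff_monom, if_pos rfl]
  have : (Matrix.of fun a b => if j a = j b then (1 : ℤ) else 0) = 1 := by
    ext a b
    simp [Matrix.one_apply, hj.eq_iff]
  rw [this, Matrix.det_one]

/-- A nonzero coefficient needs a nonzero term in the Leibniz expansion, and its permutation matches
the two index tuples; no injectivity is involved. -/
theorem exists_perm_of_coeff_monom_ne_zero {k : ℕ} {μ ν : Fin N →₀ ℕ} {j i : Fin k → Fin N}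
    (h : coeff μ j (monom ν i) ≠ 0) : ν = μ ∧ ∃ τ : Equiv.Perm (Fin k), i = j ∘ τ := by
  rw [coeff_monom] at h
  have hμ : ν = μ := by
    by_contra hne
    exact h (if_neg hne)
  refine ⟨hμ, ?_⟩
  rw [if_pos hμ, Matrix.det_apply] at h
  obtain ⟨τ, -, hτ⟩ := Finset.exists_ne_zero_of_sum_ne_zero h
  refine ⟨τ⁻¹, funext fun a => ?_⟩
  by_contra hne
  refine hτ ?_
  rw [Finset.prod_eq_zero (Finset.mem_univ (τ⁻¹ a)), smul_zero]
  rw [Matrix.of_apply, Equiv.Perm.inv_def, Equiv.apply_symm_apply]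
  exact if_neg hne

theorem coeff_comp_perm {k : ℕ} (μ : Fin N →₀ ℕ) (j : Fin k → Fin N) (τ : Equiv.Perm (Fin k))
    (f : SuperPoly N) : coeff μ (j ∘ τ) f = (Equiv.Perm.sign τ : ℤ) * coeff μ j f := by
  induction f using TensorProduct.induction_on with
  | zero => simp
  | tmul p y => rw [coeff_tmul, coeff_tmul, thetaCoeff_comp_perm, mul_left_comm]
  | add f g hf hg => rw [map_add, map_add, hf, hg, mul_add]

theorem monomBasis_repr (f : SuperPoly N) (μ : Fin N →₀ ℕ) (S : Finset (Fin N)) :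
    (monomBasis N).repr f (μ, S) = coeff μ (S.orderEmbOfFin rfl) f := by
  suffices h : ((monomBasis N).coord (μ, S)).toAddMonoidHom = coeff μ (S.orderEmbOfFin rfl) from
    DFunLike.congr_fun h f
  refine AddMonoidHom.toIntLinearMap_injective ((monomBasis N).ext fun ⟨ν, T⟩ => ?_)
  change (monomBasis N).coord (μ, S) (monomBasis N (ν, T)) =
    coeff μ (S.orderEmbOfFin rfl) (monomBasis N (ν, T))
  rw [Module.Basis.coord_apply, Module.Basis.repr_self]
  by_cases hTS : T.card = S.card
  · rw [monomBasis_apply ν T hTS]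
    by_cases h : (ν, T) = (μ, S)
    · obtain ⟨rfl, rfl⟩ := Prod.mk.inj h
      rw [Finsupp.single_eq_same]
      exact (coeff_monom_self _ (Finset.orderEmbOfFin _ _).injective).symm
    · rw [Finsupp.single_eq_of_ne (Ne.symm h)]
      by_contra hne
      obtain ⟨rfl, τ, hτ⟩ := exists_perm_of_coeff_monom_ne_zero (Ne.symm hne)
      refine h (Prod.ext rfl (Finset.eq_of_subset_of_card_le (fun a ha => ?_) hTS.ge))
      rw [← Finset.mem_coe, ← Finset.range_orderEmbOfFin T hTS] at ha
      obtain ⟨b, rfl⟩ := ha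
      rw [hτ]
      exact Finset.orderEmbOfFin_mem _ _ _
  · rw [monomBasis_apply ν T rfl, coeff_monom_of_ne hTS, Finsupp.single_eq_of_ne]
    rintro h
    exact hTS (congrArg Finset.card (Prod.mk.inj h).2.symm)

theorem eq_zero_of_coeff_eq_zero {f : SuperPoly N}
    (h : ∀ (k : ℕ) (μ : Fin N →₀ ℕ) (j : Fin k → Fin N), Function.Injective j →
      coeff μ j f = 0) : f = 0 := by
  refine (monomBasis N).ext_elem fun ⟨μ, S⟩ => ?_
  rw [monomBasis_repr, h _ _ _ (Finset.orderEmbOfFin _ _).injective, map_zero,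
    Finsupp.zero_apply]

theorem coeff_perm {k : ℕ} (σ : Equiv.Perm (Fin N)) (μ : Fin N →₀ ℕ) (j : Fin k → Fin N)
    (f : SuperPoly N) : coeff (μ.mapDomain σ) (σ ∘ j) (perm σ f) = coeff μ j f := by
  induction f using TensorProduct.induction_on with
  | zero => simp
  | tmul p y =>
    rw [perm, Algebra.TensorProduct.map_tmul, coeff_tmul, coeff_tmul, thetaCoeff_map,
      MvPolynomial.coeff_rename_mapDomain _ σ.injective, ← Function.comp_assoc,
      Equiv.symm_comp_self, Function.id_comp]
  | add f g hf hg => rw [map_add, map_add, map_add, hf, hg]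

theorem perm_monom {k : ℕ} (σ : Equiv.Perm (Fin N)) (μ : Fin N →₀ ℕ) (j : Fin k → Fin N) :
    perm σ (monom μ j) = monom (μ.mapDomain σ) (σ ∘ j) := by
  have h : ∀ i : Fin N, LinearMap.funLeft ℤ ℤ σ.symm (Pi.single i 1) =
      Pi.single (σ i) (1 : ℤ) := fun i => by
    ext j
    simp [LinearMap.funLeft_apply, Pi.single_apply, Equiv.symm_apply_eq]
  rw [monom, perm, Algebra.TensorProduct.map_tmul, MvPolynomial.rename_monomial,
    ExteriorAlgebra.map_apply_ιMulti, monom]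
  congr 2
  exact funext fun a => h (j a)

theorem perm_perm (σ τ : Equiv.Perm (Fin N)) (f : SuperPoly N) :
    perm σ (perm τ f) = perm (σ * τ) f := by
  suffices h : (perm σ : SuperPoly N →+ SuperPoly N).comp (perm τ : SuperPoly N →+ SuperPoly N) =
      (perm (σ * τ) : SuperPoly N →+ SuperPoly N) from DFunLike.congr_fun h f
  refine addMonoidHom_ext_monom fun k μ j => ?_
  change perm σ (perm τ (monom μ j)) = perm (σ * τ) (monom μ j)
  simp only [perm_monom, Equiv.Perm.coe_mul, Finsupp.mapDomain_comp, Function.comp_assoc]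

theorem perm_one (f : SuperPoly N) : perm 1 f = f := by
  suffices h : (perm (1 : Equiv.Perm (Fin N)) : SuperPoly N →+ SuperPoly N) = AddMonoidHom.id _ from
    DFunLike.congr_fun h f
  refine addMonoidHom_ext_monom fun k μ j => ?_
  change perm 1 (monom μ j) = monom μ j
  simp only [perm_monom, Equiv.Perm.coe_one, Finsupp.mapDomain_id, Function.id_comp]

/-- Setting the last variable to zero kills exactly the monomials containing it; `mapDomain` extends
`μ` by the exponent `0`. -/
theorem coeff_aeval_lastCases (μ : Fin N →₀ ℕ) (p : MvPolynomial (Fin (N + 1)) ℤ) :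
    (MvPolynomial.aeval (Fin.lastCases 0 MvPolynomial.X : Fin (N + 1) → MvPolynomial (Fin N) ℤ)
      p).coeff μ = p.coeff (μ.mapDomain Fin.castSucc) := by
  induction p using MvPolynomial.induction_on' with
  | add p q hp hq => rw [map_add, MvPolynomial.coeff_add, MvPolynomial.coeff_add, hp, hq]
  | monomial ν a =>
    rw [MvPolynomial.aeval_monomial, Finsupp.prod_fintype _ _ (by simp), Fin.prod_univ_castSucc,
      MvPolynomial.coeff_monomial]
    simp only [Fin.lastCases_castSucc, Fin.lastCases_last]
    have hlast : (μ.mapDomain Fin.castSucc) (Fin.last N) = 0 :=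
      Finsupp.mapDomain_of_notMem_range _ _ (by
        rintro ⟨i, hi⟩; exact Fin.castSucc_ne_last i hi)
    by_cases h0 : ν (Fin.last N) = 0
    · have hX : ∏ i : Fin N, (MvPolynomial.X i : MvPolynomial (Fin N) ℤ) ^ ν i.castSucc =
          MvPolynomial.monomial (Finsupp.equivFunOnFinite.symm fun i => ν i.castSucc) 1 := by
        rw [MvPolynomial.monomial_eq, Finsupp.prod_fintype _ _ (by simp)]
        simp
      rw [h0, pow_zero, mul_one, hX, MvPolynomial.algebraMap_eq, MvPolynomial.C_mul_monomial,
        MvPolynomial.coeff_monomial, mul_one]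
      congr 1
      rw [eq_iff_iff]
      constructor
      · rintro rfl
        ext i
        refine Fin.lastCases ?_ (fun i => ?_) i
        · rw [h0, hlast]
        · rw [Finsupp.mapDomain_apply (Fin.castSucc_injective N)]; rfl
      · rintro rfl
        ext i
        rw [Finsupp.equivFunOnFinite_symm_apply_apply,
          Finsupp.mapDomain_apply (Fin.castSucc_injective N)]
    · rw [zero_pow h0, mul_zero, mul_zero, MvPolynomial.coeff_zero, if_neg]
      rintro rfl
      exact h0 hlast

theorem coeff_restrict {k : ℕ} (μ : Fin N →₀ ℕ) (j : Fin k → Fin N) (f : SuperPoly (N + 1)) :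
    coeff μ j (restrict N f) = coeff (μ.mapDomain Fin.castSucc) (Fin.castSucc ∘ j) f := by
  induction f using TensorProduct.induction_on with
  | zero => simp
  | tmul p y =>
    rw [restrict, Algebra.TensorProduct.map_tmul, coeff_tmul, coeff_tmul, thetaCoeff_map,
      coeff_aeval_lastCases]
  | add f g hf hg => rw [map_add, map_add, map_add, hf, hg]

end SuperPoly

end

/-! ### Monomial symmetric superpolynomials -/

noncomputable section

theorem compSeq_append (l l' : List ℕ) (i : ℕ) :
    compSeq (l ++ l') i = if i < l.length then compSeq l i else compSeq l' (i - l.length) := by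
  unfold compSeq
  split_ifs with h
  · exact List.getD_append _ _ _ _ h
  · exact List.getD_append_right _ _ _ _ (not_lt.1 h)

theorem compSeq_of_lt {l : List ℕ} {i : ℕ} (h : i < l.length) : compSeq l i = l[i] :=
  List.getD_eq_getElem _ _ h

theorem countP_lt_eq_sum (l : List ℕ) (c : ℕ) {N : ℕ} (h : l.length ≤ N) :
    l.countP (fun p => decide (c < p)) = ∑ i : Fin N, if c < compSeq l i then 1 else 0 := by
  induction l generalizing N with
  | nil => simp [compSeq]
  | cons a l ih =>
    obtain ⟨N, rfl⟩ : ∃ k, N = k + 1 := ⟨N - 1, by simp at h; omega⟩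
    rw [Fin.sum_univ_succ, List.countP_cons, ih (N := N) (by simpa using h), add_comm]
    simp [compSeq]

theorem compSeq_filter_pos {l : List ℕ} (hl : l.Pairwise (· ≥ ·)) :
    compSeq (l.filter (fun p => decide (0 < p))) = compSeq l := by
  funext r
  refine eq_of_forall_lt_iff fun c => ?_
  rw [lt_compSeq_iff (hl.filter _), lt_compSeq_iff hl, List.countP_filter]
  refine iff_of_eq (congrArg (r < ·) (List.countP_congr fun p _ => ?_))
  simp only [Bool.and_eq_true, decide_eq_true_eq]
  omega

/-- Normal form of a sorted monomial. Zeros among the last `N - k` exponents are filtered out, which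
`compSeq` does not notice. -/
theorem exists_superPartition_comp {N k : ℕ} (hk : k ≤ N) (ν : Fin N → ℕ)
    (h₁ : ∀ a b : Fin N, a < b → (b : ℕ) < k → ν b < ν a)
    (h₂ : ∀ a b : Fin N, k ≤ (a : ℕ) → a ≤ b → ν b ≤ ν a) :
    ∃ Λ : SuperPartition, Λ.anti.length = k ∧ Λ.length ≤ N ∧
      ∀ i : Fin N, compSeq Λ.comp i = ν i := by
  have hs : (List.ofFn fun b : Fin (N - k) => ν ⟨k + b, by omega⟩).Pairwise (· ≥ ·) := by
    rw [List.pairwise_ofFn]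
    intro a b hab
    exact h₂ _ _ (by simp) (by simp only [Fin.mk_le_mk]; have : (a : ℕ) < b := hab; omega)
  refine ⟨⟨List.ofFn fun a : Fin k => ν (Fin.castLE hk a),
    (List.ofFn fun b : Fin (N - k) => ν ⟨k + b, by omega⟩).filter (fun p => decide (0 < p)),
    ?_, hs.filter _, ?_⟩, ?_, ?_, fun i => ?_⟩
  · rw [List.pairwise_ofFn]
    intro a b hab
    exact h₁ _ _ hab b.2
  · intro p hp
    simpa using (List.mem_filter.1 hp).2
  · simp
  · have := List.length_filter_le (fun p => decide (0 < p))
      (List.ofFn fun b : Fin (N - k) => ν ⟨k + b, by omega⟩)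
    simp only [SuperPartition.length, List.length_ofFn] at this ⊢
    omega
  · rw [SuperPartition.comp, compSeq_append, List.length_ofFn, compSeq_filter_pos hs]
    split_ifs with hi
    · rw [compSeq_of_lt (by simpa using hi), List.getElem_ofFn]; rfl
    · have hi' : (i : ℕ) - k < N - k := by omega
      rw [compSeq_of_lt (by simpa using hi'), List.getElem_ofFn]
      congr 1
      exact Fin.ext (by simp; omega)

namespace SuperPartition

theorem anti_length_le_length (Λ : SuperPartition) : Λ.anti.length ≤ Λ.length :=
  Nat.le_add_right _ _

theorem compSeq_comp_of_lt (Λ : SuperPartition) {k : ℕ} (hk : k < Λ.anti.length) :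
    compSeq Λ.comp k = Λ.anti[k] := by
  rw [comp, compSeq_append, if_pos hk, compSeq_of_lt hk]

/-- The exponent vector `Λᶜ`. -/
def expo (Λ : SuperPartition) (N : ℕ) : Fin N →₀ ℕ :=
  Finsupp.equivFunOnFinite.symm fun i => compSeq Λ.comp i

theorem expo_apply (Λ : SuperPartition) {N : ℕ} (i : Fin N) :
    Λ.expo N i = compSeq Λ.comp i := rfl

theorem degree_expo (Λ : SuperPartition) {N : ℕ} (h : Λ.length ≤ N) :
    (Λ.expo N).degree = Λ.degree := by
  rw [Finsupp.degree_eq_sum, degree, sum_eq_sum_compSeq _ (Λ.length_comp.trans_le h),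
    ← Fin.sum_univ_eq_sum_range]
  rfl

end SuperPartition

/-! ### Leading coefficients of symmetric superpolynomials -/

namespace SuperPoly

variable {N : ℕ}

theorem leading_eq_monom (Λ : SuperPartition) (h : Λ.length ≤ N) {k : ℕ}
    (hk : Λ.anti.length = k) :
    leading Λ h =
      monom (Λ.expo N) (Fin.castLE (hk.symm.trans_le (Λ.anti_length_le_length.trans h))) := by
  subst hk
  have hX : ∏ i : Fin N, (MvPolynomial.X i : MvPolynomial (Fin N) ℤ) ^ compSeq Λ.comp i =
      MvPolynomial.monomial (Λ.expo N) 1 := by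
    rw [MvPolynomial.monomial_eq, Finsupp.prod_fintype _ _ (by simp)]
    simp [SuperPartition.expo_apply]
  rw [leading, list_ofFn_θ_mul_ofPoly, hX]
  rfl

/-- The coefficient of the leading monomial of `m_Λ`. -/
def monoCoeff (N : ℕ) (Λ : SuperPartition) : SuperPoly N →+ ℤ :=
  if h : Λ.length ≤ N then coeff (Λ.expo N) (Fin.castLE (Λ.anti_length_le_length.trans h)) else 0

theorem monoCoeff_eq_coeff (Λ : SuperPartition) (h : Λ.length ≤ N) {k : ℕ}
    (hk : Λ.anti.length = k) :
    monoCoeff N Λ =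
      coeff (Λ.expo N) (Fin.castLE (hk.symm.trans_le (Λ.anti_length_le_length.trans h))) := by
  subst hk
  exact dif_pos h

theorem monoCoeff_of_not_le (Λ : SuperPartition) (h : ¬ Λ.length ≤ N) : monoCoeff N Λ = 0 :=
  dif_neg h

theorem length_le_of_monoCoeff_ne_zero {Λ : SuperPartition} {f : SuperPoly N}
    (h : monoCoeff N Λ f ≠ 0) : Λ.length ≤ N := by
  by_contra hn
  rw [monoCoeff_of_not_le Λ hn] at h
  exact h rfl

/-- Swapping the two variables preserves the exponents and exchanges two `θ`'s, so the coefficient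
equals its own negative, and `ℤ` has no 2-torsion. -/
theorem coeff_eq_zero_of_eq {f : SuperPoly N} (hf : ∀ σ, perm σ f = f) {k : ℕ}
    (μ : Fin N →₀ ℕ) (j : Fin k → Fin N) {a b : Fin k} (hab : a ≠ b)
    (hj : Function.Injective j) (h : μ (j a) = μ (j b)) : coeff μ j f = 0 := by
  have h1 := coeff_perm (Equiv.swap (j a) (j b)) μ j f
  have hμ : μ.mapDomain (Equiv.swap (j a) (j b)) = μ := by
    ext i
    rw [← Finsupp.equivMapDomain_eq_mapDomain, Finsupp.equivMapDomain_apply, Equiv.symm_swap,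
      Equiv.swap_apply_def]
    split_ifs with h1 h2
    · rw [h1, h]
    · rw [h2, h]
    · rfl
  have hj' : Equiv.swap (j a) (j b) ∘ j = j ∘ Equiv.swap a b := by
    funext c
    exact hj.swap_apply a b c
  rw [hf, hμ, hj', coeff_comp_perm, Equiv.Perm.sign_swap hab] at h1
  simp at h1
  omega

/-- By symmetry any monomial may be moved until the variables carrying a `θ` come first and
exponents decrease within both groups. It is then, up to sign, the leading monomial of a
superpartition, unless two fermionic exponents coincide and `coeff_eq_zero_of_eq` applies. -/
theorem eq_zero_of_monoCoeff_eq_zero {f : SuperPoly N} (hf : f ∈ symmetric N)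
    (h : ∀ Λ, Λ.length ≤ N → monoCoeff N Λ f = 0) : f = 0 := by
  rw [mem_symmetric] at hf
  refine eq_zero_of_coeff_eq_zero fun k μ j hj => ?_
  classical
  have hk : k ≤ N := by simpa using Fintype.card_le_of_injective j hj
  obtain ⟨R, hR⟩ : ∃ R, R = Set.range j := ⟨_, rfl⟩
  -- Sorting by this key puts the indices of the `θ`'s first and orders exponents decreasingly
  -- inside each group.
  let key : Fin N → ℕ ×ₗ ℕᵒᵈ := fun i =>
    toLex (if i ∈ R then 0 else 1, OrderDual.toDual (μ i))
  set s := Tuple.sort key with hs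
  have hmono : Monotone (key ∘ s) := Tuple.monotone_sort key
  have hle : ∀ a b : Fin N, a ≤ b → s b ∈ R → s a ∈ R := by
    intro a b hab hb
    by_contra ha
    have := hmono hab
    rw [Prod.Lex.le_iff] at this
    simp [key, ha, hb] at this
  -- The positions sorted into `R` form an initial segment with `k` elements.
  have hmem : ∀ a : Fin N, s a ∈ R ↔ (a : ℕ) < k := by
    set A : Finset (Fin N) := Finset.univ.filter fun a => s a ∈ R with hA
    have hAk : A.card = k := by
      have : A = (Finset.univ.image j).map s.symm.toEmbedding := by
        ext a
        simp [hA, hR]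
      rw [this, Finset.card_map, Finset.card_image_of_injective _ hj, Finset.card_univ,
        Fintype.card_fin]
    intro a
    constructor
    · intro ha
      have hsub : Finset.Iic a ⊆ A := fun b hb => by
        rw [hA, Finset.mem_filter]
        exact ⟨Finset.mem_univ _, hle b a (Finset.mem_Iic.1 hb) ha⟩
      have := Finset.card_le_card hsub
      rw [hAk, Fin.card_Iic] at this
      omega
    · intro ha
      by_contra hn
      have hsub : A ⊆ Finset.Iio a := fun b hb => by
        rw [hA, Finset.mem_filter] at hb
        rw [Finset.mem_Iio]
        by_contra hba
        exact hn (hle a b (not_lt.1 hba) hb.2)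
      have := Finset.card_le_card hsub
      rw [hAk, Fin.card_Iio] at this
      omega
  have hanti : ∀ a b : Fin N, a ≤ b → ((a : ℕ) < k ↔ (b : ℕ) < k) → μ (s b) ≤ μ (s a) := by
    intro a b hab hab'
    have := hmono hab
    rw [Prod.Lex.le_iff] at this
    rw [← hmem, ← hmem] at hab'
    simpa [key, hab'] using this
  have hτ₀ : ∀ b : Fin k, ((s.symm (j b) : Fin N) : ℕ) < k := fun b =>
    (hmem _).1 (by rw [Equiv.apply_symm_apply, hR]; exact ⟨b, rfl⟩)
  -- The order of the `θ`'s in `j` differs from the sorted order by `τ`, which costs only a sign.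
  let τ : Equiv.Perm (Fin k) := Equiv.ofBijective (fun b => ⟨s.symm (j b), hτ₀ b⟩)
    (Finite.injective_iff_bijective.1 fun b c hbc => by
      simp only [Fin.mk.injEq] at hbc
      exact hj (s.symm.injective (Fin.ext hbc)))
  have hjτ : j = s ∘ (Fin.castLE hk ∘ τ) := by
    funext b
    have : Fin.castLE hk (τ b) = s.symm (j b) := Fin.ext rfl
    simp [this]
  set ν : Fin N →₀ ℕ := μ.mapDomain s.symm with hν
  have hνs : ∀ i, ν i = μ (s i) := fun i => by
    rw [hν, ← Finsupp.equivMapDomain_eq_mapDomain, Finsupp.equivMapDomain_apply, Equiv.symm_symm]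
  have hμν : μ = ν.mapDomain s := by
    rw [hν, ← Finsupp.mapDomain_comp, Equiv.self_comp_symm, Finsupp.mapDomain_id]
  rw [hμν, hjτ, ← hf s, coeff_perm, coeff_comp_perm]
  suffices h0 : coeff ν (Fin.castLE hk) f = 0 by rw [h0, mul_zero]
  by_cases hinj : ∀ a b : Fin k, ν (Fin.castLE hk a) = ν (Fin.castLE hk b) → a = b
  · obtain ⟨Λ, hΛk, hΛN, hΛ⟩ := exists_superPartition_comp hk ν (fun a b hab hb => by
        rw [hνs, hνs]
        refine lt_of_le_of_ne (hanti a b hab.le ⟨fun _ => hb, fun _ => lt_trans hab hb⟩)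
          fun he => hab.ne' ?_
        have := hinj ⟨b, hb⟩ ⟨a, lt_trans hab hb⟩ (by rw [hνs, hνs]; exact he)
        exact Fin.ext (by simpa using this))
      (fun a b ha hab => by
        rw [hνs, hνs]
        exact hanti a b hab ⟨fun h => by omega, fun h => by have : (a : ℕ) ≤ b := hab; omega⟩)
    have hexp : Λ.expo N = ν := Finsupp.ext hΛ
    rw [← hexp, ← monoCoeff_eq_coeff Λ hΛN hΛk]
    exact h Λ hΛN
  · push Not at hinj
    obtain ⟨a, b, hab, hne⟩ := hinj
    exact coeff_eq_zero_of_eq hf ν _ hne (Fin.castLE_injective hk) hab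

theorem eq_of_monoCoeff_eq {f g : SuperPoly N} (hf : f ∈ symmetric N) (hg : g ∈ symmetric N)
    (h : ∀ Λ, Λ.length ≤ N → monoCoeff N Λ f = monoCoeff N Λ g) : f = g :=
  sub_eq_zero.1 <| eq_zero_of_monoCoeff_eq_zero (sub_mem hf hg) fun Λ hΛ => by
    rw [map_sub, h Λ hΛ, sub_self]

/-- Matching exponents makes the two strictly decreasing fermionic sequences rearrangements of each
other, hence equal, and forces the reordering `τ` of the `θ`'s to be trivial. So the negative of a
leading monomial never occurs among the terms of `m_Λ`. -/
theorem monoCoeff_perm_leading {Ω Λ : SuperPartition} (hΛ : Λ.length ≤ N)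
    {σ : Equiv.Perm (Fin N)} (h : monoCoeff N Ω (perm σ (leading Λ hΛ)) ≠ 0) :
    Ω = Λ ∧ perm σ (leading Λ hΛ) = leading Λ hΛ := by
  have hΩ := length_le_of_monoCoeff_ne_zero h
  rw [leading_eq_monom Λ hΛ rfl, perm_monom] at h ⊢
  have hk : Ω.anti.length = Λ.anti.length := by
    by_contra hne
    rw [monoCoeff_eq_coeff Ω hΩ rfl] at h
    exact h (coeff_monom_of_ne (Ne.symm hne) _ _ _ _)
  rw [monoCoeff_eq_coeff Ω hΩ hk] at h
  obtain ⟨hexp, τ, hτ⟩ := exists_perm_of_coeff_monom_ne_zero h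
  have hcomp : ∀ i : Fin N, compSeq Ω.comp (σ i) = compSeq Λ.comp i := fun i => by
    rw [← SuperPartition.expo_apply, ← hexp, Finsupp.mapDomain_apply σ.injective]; rfl
  have hmk : ∀ a : Fin Λ.anti.length, Ω.anti[(τ a : ℕ)] = Λ.anti[(a : ℕ)] := fun a => by
    have h1 := hcomp (Fin.castLE (Λ.anti_length_le_length.trans hΛ) a)
    have h2 : σ (Fin.castLE (Λ.anti_length_le_length.trans hΛ) a) = _ := congrFun hτ a
    rw [h2] at h1
    simp only [Function.comp_apply, Fin.val_castLE] at h1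
    rwa [Ω.compSeq_comp_of_lt ((τ a).2.trans_eq hk.symm), Λ.compSeq_comp_of_lt a.2] at h1
  have hanti : Ω.anti = Λ.anti := by
    refine List.Perm.eq_of_pairwise (le := (· > ·)) ?_ Ω.anti_sorted Λ.anti_sorted
      ((List.perm_ext_iff_of_nodup Ω.anti_nodup Λ.anti_nodup).2 fun p => ?_)
    · intro a b _ _ hab hba
      omega
    · constructor
      · intro hp
        obtain ⟨i, hi, rfl⟩ := List.getElem_of_mem hp
        have := hmk (τ.symm ⟨i, hi.trans_eq hk⟩)
        simp only [Equiv.apply_symm_apply] at this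
        rw [this]
        exact List.getElem_mem _
      · intro hp
        obtain ⟨i, hi, rfl⟩ := List.getElem_of_mem hp
        rw [← hmk ⟨i, hi⟩]
        exact List.getElem_mem _
  have hΩΛ : Ω = Λ := by
    refine SuperPartition.eq_of_colLength_eq hanti fun c => ?_
    rw [SuperPartition.colLength, SuperPartition.colLength,
      countP_lt_eq_sum _ c (Ω.length_comp.trans_le hΩ),
      countP_lt_eq_sum _ c (Λ.length_comp.trans_le hΛ), ← Equiv.sum_comp σ]
    exact Finset.sum_congr rfl fun i _ => by rw [hcomp]
  refine ⟨hΩΛ, ?_⟩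
  subst hΩΛ
  have hτ1 : ∀ a, τ a = a := fun a =>
    Fin.ext ((Ω.anti_nodup.getElem_inj_iff (hi := (τ a).2) (hj := a.2)).1 (hmk a))
  rw [hexp, hτ]
  congr 1
  funext a
  rw [Function.comp_apply, hτ1]

theorem monoCoeff_leading (Λ : SuperPartition) (h : Λ.length ≤ N) :
    monoCoeff N Λ (leading Λ h) = 1 := by
  rw [monoCoeff_eq_coeff Λ h rfl, leading_eq_monom Λ h rfl,
    coeff_monom_self _ (Fin.castLE_injective _)]

theorem mono_of_not_le {Λ : SuperPartition} (h : ¬ Λ.length ≤ N) : mono N Λ = 0 := dif_neg h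

theorem monoCoeff_mono_self {Λ : SuperPartition} (h : Λ.length ≤ N) :
    monoCoeff N Λ (mono N Λ) = 1 := by
  classical
  rw [mono, dif_pos h, map_sum, Finset.sum_eq_single (leading Λ h), monoCoeff_leading]
  · intro f hf hne
    obtain ⟨σ, -, rfl⟩ := Finset.mem_image.1 hf
    by_contra h0
    exact hne (monoCoeff_perm_leading h h0).2
  · intro hn
    exact absurd (Finset.mem_image.2 ⟨1, Finset.mem_univ 1, perm_one (leading Λ h)⟩) hn

theorem monoCoeff_mono_of_ne {Ω Λ : SuperPartition} (h : Ω ≠ Λ) :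
    monoCoeff N Ω (mono N Λ) = 0 := by
  classical
  by_cases hΛ : Λ.length ≤ N
  · rw [mono, dif_pos hΛ, map_sum]
    refine Finset.sum_eq_zero fun f hf => ?_
    obtain ⟨σ, -, rfl⟩ := Finset.mem_image.1 hf
    by_contra h0
    exact h (monoCoeff_perm_leading hΛ h0).1
  · rw [mono_of_not_le hΛ, map_zero]

theorem mono_mem_symmetric (N : ℕ) (Λ : SuperPartition) : mono N Λ ∈ symmetric N := by
  classical
  rw [mem_symmetric]
  intro τ
  by_cases hΛ : Λ.length ≤ N
  · rw [mono, dif_pos hΛ, map_sum]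
    refine Finset.sum_nbij' (perm τ) (perm τ⁻¹) ?_ ?_ ?_ ?_ fun _ _ => rfl
    · intro f hf
      obtain ⟨σ, -, rfl⟩ := Finset.mem_image.1 hf
      exact Finset.mem_image.2 ⟨τ * σ, Finset.mem_univ _, (perm_perm _ _ _).symm⟩
    · intro f hf
      obtain ⟨σ, -, rfl⟩ := Finset.mem_image.1 hf
      exact Finset.mem_image.2 ⟨τ⁻¹ * σ, Finset.mem_univ _, (perm_perm _ _ _).symm⟩
    · intro f _
      rw [perm_perm, inv_mul_cancel, perm_one]
    · intro f _
      rw [perm_perm, mul_inv_cancel, perm_one]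
  · rw [mono_of_not_le hΛ, map_zero]

theorem degree_eq_of_coeff_ne_zero {n m k : ℕ} {f : SuperPoly N} (hf : f ∈ homogeneous N n m)
    {μ : Fin N →₀ ℕ} {j : Fin k → Fin N} (h : coeff μ j f ≠ 0) : μ.degree = n ∧ k = m := by
  by_contra hn
  refine h ?_
  induction hf using Submodule.span_induction with
  | mem f hf =>
    obtain ⟨ν, i, hν, rfl⟩ := hf
    rw [ofPoly_mul_list_ofFn_θ]
    by_contra h0
    by_cases hk : m = k
    · subst hk
      have := (exists_perm_of_coeff_monom_ne_zero h0).1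
      rw [← this, hν] at hn
      exact hn ⟨rfl, rfl⟩
    · exact h0 (coeff_monom_of_ne hk _ _ _ _)
  | zero => exact map_zero _
  | add f g _ _ hf hg =>
    rw [map_add, by_contra fun h => h (hf h), by_contra fun h => h (hg h), add_zero]
  | smul c f _ hf =>
    rw [map_zsmul, by_contra fun h => h (hf h), smul_zero]

theorem mem_SPar_of_monoCoeff_ne_zero {n m : ℕ} {f : SuperPoly N} (hf : f ∈ homogeneous N n m)
    {Λ : SuperPartition} (h : monoCoeff N Λ f ≠ 0) : Λ.degree = n ∧ Λ.fermionicDegree = m := by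
  have hΛ := length_le_of_monoCoeff_ne_zero h
  rw [monoCoeff_eq_coeff Λ hΛ rfl] at h
  rw [← Λ.degree_expo hΛ]
  exact degree_eq_of_coeff_ne_zero hf h

theorem eq_sum_mono_of_support {f : SuperPoly N} (hf : f ∈ symmetric N)
    (T : Finset SuperPartition) (hT : ∀ Λ, monoCoeff N Λ f ≠ 0 → Λ ∈ T) :
    f = ∑ Λ ∈ T, monoCoeff N Λ f • mono N Λ := by
  classical
  refine eq_of_monoCoeff_eq hf
    (Subalgebra.sum_mem _ fun Λ _ => zsmul_mem (mono_mem_symmetric N Λ) _) fun Ω hΩ => ?_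
  rw [map_sum]
  simp only [map_zsmul]
  by_cases hmem : Ω ∈ T
  · rw [Finset.sum_eq_single Ω, monoCoeff_mono_self hΩ]
    · simp
    · intro Λ _ hne
      rw [monoCoeff_mono_of_ne hne.symm, smul_zero]
    · exact fun h => absurd hmem h
  · rw [Finset.sum_eq_zero]
    · by_contra h0
      exact hmem (hT Ω h0)
    · intro Λ hΛ
      rw [monoCoeff_mono_of_ne, smul_zero]
      rintro rfl
      exact hmem hΛ

/-- A monomial has leading coefficients only at superpartitions of its own bidegree, of which there
are finitely many, and finiteness is preserved by sums. -/
theorem finite_monoCoeff_ne_zero (f : SuperPoly N) : {Λ | monoCoeff N Λ f ≠ 0}.Finite := by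
  let H : AddSubgroup (SuperPoly N) :=
    { carrier := {f | {Λ | monoCoeff N Λ f ≠ 0}.Finite}
      zero_mem' := by simp
      add_mem' := fun {f g} hf hg => (hf.union hg).subset fun Λ hΛ => by
        by_contra h
        simp only [Set.mem_union, Set.mem_ofPred_eq, not_or, not_not] at h
        exact hΛ (by rw [map_add, h.1, h.2, add_zero])
      neg_mem' := fun {f} hf => by simpa using hf }
  refine mem_of_monom_mem H (fun k μ j => ?_) f
  exact (Set.finite_range (Subtype.val : SPar μ.degree k → SuperPartition)).subset
    fun Λ hΛ => ⟨⟨Λ, mem_SPar_of_monoCoeff_ne_zero (monom_mem_homogeneous μ j) hΛ⟩, rfl⟩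

instance (n m : ℕ) : Fintype (SPar n m) := Fintype.ofFinite _

theorem eq_sum_mono {n m : ℕ} {f : SuperPoly N} (hf : f ∈ symmetric N)
    (hh : f ∈ homogeneous N n m) : f = ∑ Λ : SPar n m, monoCoeff N Λ.1 f • mono N Λ.1 := by
  classical
  have h := eq_sum_mono_of_support hf (Finset.univ.map (Function.Embedding.subtype fun Λ =>
    SuperPartition.degree Λ = n ∧ SuperPartition.fermionicDegree Λ = m)) fun Λ hΛ => by
      simpa using mem_SPar_of_monoCoeff_ne_zero hh hΛ
  rw [Finset.sum_map] at h
  exact h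

theorem monoCoeff_restrict {Λ : SuperPartition} (h : Λ.length ≤ N) (f : SuperPoly (N + 1)) :
    monoCoeff N Λ (restrict N f) = monoCoeff (N + 1) Λ f := by
  have hexp : (Λ.expo N).mapDomain Fin.castSucc = Λ.expo (N + 1) := by
    ext i
    refine Fin.lastCases ?_ (fun i => ?_) i
    · rw [Finsupp.mapDomain_of_notMem_range _ _ (by
        rintro ⟨i, hi⟩; exact Fin.castSucc_ne_last i hi), SuperPartition.expo_apply,
        compSeq_eq_zero (Λ.length_comp.trans_le (by simpa using h))]
    · rw [Finsupp.mapDomain_apply (Fin.castSucc_injective N)]; rfl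
  rw [monoCoeff_eq_coeff Λ h rfl, monoCoeff_eq_coeff Λ (h.trans (Nat.le_succ N)) rfl,
    coeff_restrict, hexp]
  rfl

end SuperPoly

/-! ### Monomial expansion of symmetric superfunctions -/

theorem monoCoeff_symSuperfunction {n m : ℕ} {f : ∀ N, SuperPoly N}
    (hf : f ∈ symSuperfunction n m) (Λ : SuperPartition) {N M : ℕ} (hN : Λ.length ≤ N)
    (hM : Λ.length ≤ M) :
    SuperPoly.monoCoeff N Λ (f N) = SuperPoly.monoCoeff M Λ (f M) := by
  have key : ∀ N, Λ.length ≤ N →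
      SuperPoly.monoCoeff N Λ (f N) = SuperPoly.monoCoeff Λ.length Λ (f Λ.length) := by
    intro N hN
    induction N, hN using Nat.le_induction with
    | base => rfl
    | succ N hN ih => rw [← ih, ← SuperPoly.monoCoeff_restrict hN, (hf N).2.2]
  rw [key N hN, key M hM]

/-- With `n + m` pairs of variables every `m_Λ` of this bidegree survives, so the coefficients can
be read there; for smaller `N` the terms that become invisible vanish. -/
theorem symSuperfunction_eq_sum {n m : ℕ} {f : ∀ N, SuperPoly N}
    (hf : f ∈ symSuperfunction n m) :
    f = ∑ Λ : SPar n m, SuperPoly.monoCoeff (n + m) Λ.1 (f (n + m)) • mSuper Λ.1 := by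
  funext N
  rw [Finset.sum_apply]
  refine (SuperPoly.eq_sum_mono (hf N).2.1 (hf N).1).trans
    (Finset.sum_congr rfl fun Λ _ => ?_)
  by_cases h : Λ.1.length ≤ N
  · rw [monoCoeff_symSuperfunction hf Λ.1 h Λ.length_le]; rfl
  · rw [SuperPoly.mono_of_not_le h, smul_zero]
    rw [Pi.smul_apply, mSuper, SuperPoly.mono_of_not_le h, smul_zero]

end

/-! ### Elementary symmetric superpolynomials -/

noncomputable section

namespace SuperPoly

variable {N : ℕ}

theorem ofPoly_add (p q : MvPolynomial (Fin N) ℤ) : ofPoly (p + q) = ofPoly p + ofPoly q :=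
  TensorProduct.add_tmul _ _ _

theorem ofPoly_mul (p q : MvPolynomial (Fin N) ℤ) : ofPoly (p * q) = ofPoly p * ofPoly q :=
  map_mul (Algebra.TensorProduct.includeLeft (R := ℤ) (S := ℤ)
    (A := MvPolynomial (Fin N) ℤ) (B := ExteriorAlgebra ℤ (Fin N → ℤ))) p q

theorem ofPoly_one : ofPoly (1 : MvPolynomial (Fin N) ℤ) = 1 := rfl

theorem ofPoly_zero : ofPoly (0 : MvPolynomial (Fin N) ℤ) = 0 := TensorProduct.zero_tmul _ _

theorem ofPoly_sum {ι : Type*} (s : Finset ι) (p : ι → MvPolynomial (Fin N) ℤ) :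
    ofPoly (∑ i ∈ s, p i) = ∑ i ∈ s, ofPoly (p i) := TensorProduct.sum_tmul _ _ _

theorem ofPoly_comm (p : MvPolynomial (Fin N) ℤ) (f : SuperPoly N) :
    ofPoly p * f = f * ofPoly p := by
  induction f using TensorProduct.induction_on with
  | zero => rw [mul_zero, zero_mul]
  | tmul q y =>
    rw [ofPoly, Algebra.TensorProduct.tmul_mul_tmul, Algebra.TensorProduct.tmul_mul_tmul,
      one_mul, mul_one, mul_comm]
  | add f g hf hg => rw [mul_add, add_mul, hf, hg]

theorem perm_ofPoly (σ : Equiv.Perm (Fin N)) (p : MvPolynomial (Fin N) ℤ) :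
    perm σ (ofPoly p) = ofPoly (MvPolynomial.rename σ p) := by
  simp [perm, ofPoly]

theorem restrict_ofPoly (p : MvPolynomial (Fin (N + 1)) ℤ) :
    restrict N (ofPoly p) = ofPoly (MvPolynomial.aeval (Fin.lastCases 0 MvPolynomial.X) p) := by
  simp [restrict, ofPoly]

theorem perm_ofPoly_prod_X (σ : Equiv.Perm (Fin N)) (J : Finset (Fin N)) :
    perm σ (ofPoly (∏ j ∈ J, MvPolynomial.X j)) =
      ofPoly (∏ j ∈ J.map σ.toEmbedding, MvPolynomial.X j) := by
  rw [perm_ofPoly, map_prod, Finset.prod_map]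
  simp

theorem restrict_ofPoly_prod_X (J : Finset (Fin N)) :
    restrict N (ofPoly (∏ j ∈ J.map Fin.castSuccEmb, MvPolynomial.X j)) =
      ofPoly (∏ j ∈ J, MvPolynomial.X j) := by
  rw [restrict_ofPoly, map_prod, Finset.prod_map]
  simp

theorem restrict_ofPoly_prod_X_of_mem {J : Finset (Fin (N + 1))} (h : Fin.last N ∈ J) :
    restrict N (ofPoly (∏ j ∈ J, MvPolynomial.X j)) = 0 := by
  rw [restrict_ofPoly, map_prod, Finset.prod_eq_zero h, ofPoly_zero]
  simp

theorem exists_map_castSucc {J : Finset (Fin (N + 1))} (h : Fin.last N ∉ J) :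
    ∃ J' : Finset (Fin N), J'.map Fin.castSuccEmb = J := by
  refine ⟨Finset.univ.filter fun i => i.castSucc ∈ J, ?_⟩
  ext i
  refine Fin.lastCases ?_ (fun i => ?_) i
  · simp [h, Fin.castSucc_ne_last]
  · simp

/-- The index set of the monomials of `ẽ_n`. -/
def columns (N n : ℕ) : Finset (Fin N × Finset (Fin N)) :=
  (Finset.univ ×ˢ Finset.powersetCard n Finset.univ).filter fun p => p.1 ∉ p.2

theorem mem_columns {n : ℕ} {p : Fin N × Finset (Fin N)} :
    p ∈ columns N n ↔ p.2.card = n ∧ p.1 ∉ p.2 := by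
  simp [columns, Finset.mem_powersetCard]

theorem eTilde_eq_sum (N n : ℕ) :
    eTilde N n = ∑ p ∈ columns N n, θ p.1 * ofPoly (∏ j ∈ p.2, MvPolynomial.X j) := by
  rw [columns, Finset.sum_filter, Finset.sum_product, eTilde]
  refine Finset.sum_congr rfl fun i _ => ?_
  rw [← Finset.sum_filter]
  refine Finset.sum_congr ?_ fun _ _ => rfl
  ext J
  simp only [Finset.mem_powersetCard, Finset.mem_filter, Finset.subset_erase,
    Finset.subset_univ, true_and]
  exact and_comm

theorem e_mem_symmetric (N n : ℕ) : e N n ∈ symmetric N := by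
  rw [mem_symmetric]
  intro σ
  rw [e, map_sum]
  refine Finset.sum_nbij' (fun J => J.map σ.toEmbedding) (fun J => J.map σ.symm.toEmbedding)
    ?_ ?_ ?_ ?_ fun J _ => perm_ofPoly_prod_X σ J
  · intro J hJ
    simpa [Finset.mem_powersetCard] using hJ
  · intro J hJ
    simpa [Finset.mem_powersetCard] using hJ
  · intro J _
    ext; simp
  · intro J _
    ext; simp

theorem eTilde_mem_symmetric (N n : ℕ) : eTilde N n ∈ symmetric N := by
  rw [mem_symmetric]
  intro σ
  rw [eTilde_eq_sum, map_sum]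
  refine Finset.sum_nbij' (fun p => (σ p.1, p.2.map σ.toEmbedding))
    (fun p => (σ.symm p.1, p.2.map σ.symm.toEmbedding)) ?_ ?_ ?_ ?_ fun p _ => ?_
  · intro p hp
    simpa [mem_columns] using hp
  · intro p hp
    simpa [mem_columns] using hp
  · intro p _
    ext <;> simp
  · intro p _
    ext <;> simp
  · rw [map_mul, perm_θ, perm_ofPoly_prod_X]

theorem restrict_e (N n : ℕ) : restrict N (e (N + 1) n) = e N n := by
  rw [e, map_sum, e]
  symm
  refine Finset.sum_of_injOn (fun J => J.map Fin.castSuccEmb)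
    (Finset.map_injective _).injOn ?_ ?_ fun J _ => (restrict_ofPoly_prod_X J).symm
  · intro J hJ
    simpa [Finset.mem_powersetCard] using hJ
  · intro J hJ hn
    by_cases h : Fin.last N ∈ J
    · exact restrict_ofPoly_prod_X_of_mem h
    · obtain ⟨J', rfl⟩ := exists_map_castSucc h
      exact absurd ⟨J', by simpa [Finset.mem_powersetCard] using hJ, rfl⟩ hn

theorem restrict_eTilde (N n : ℕ) : restrict N (eTilde (N + 1) n) = eTilde N n := by
  rw [eTilde_eq_sum, map_sum, eTilde_eq_sum]
  symm
  refine Finset.sum_of_injOn (fun p => (Fin.castSucc p.1, p.2.map Fin.castSuccEmb))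
    ?_ ?_ ?_ fun p _ => ?_
  · rintro ⟨i, J⟩ - ⟨i', J'⟩ - h
    simp only [Prod.mk.injEq, Fin.castSucc_inj, Finset.map_inj] at h
    exact Prod.ext h.1 h.2
  · intro p hp
    simpa [mem_columns] using hp
  · rintro ⟨i, J⟩ hJ hn
    rw [map_mul]
    by_cases h : Fin.last N ∈ J
    · rw [restrict_ofPoly_prod_X_of_mem h, mul_zero]
    · obtain ⟨J', rfl⟩ := exists_map_castSucc h
      refine Fin.lastCases (fun _ _ => ?_) (fun i hJ hn => ?_) i hJ hn
      · rw [restrict_θ_last, zero_mul]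
      · exact absurd ⟨(i, J'), by simpa [mem_columns] using hJ, rfl⟩ hn
  · rw [map_mul, restrict_θ, restrict_ofPoly_prod_X]

theorem e_eq_zero {n : ℕ} (h : N < n) : e N n = 0 := by
  rw [e, Finset.powersetCard_eq_empty.2 (by simpa using h), Finset.sum_empty]

theorem eTilde_eq_zero {n : ℕ} (h : N ≤ n) : eTilde N n = 0 := by
  rw [eTilde]
  refine Finset.sum_eq_zero fun i _ => ?_
  rw [Finset.powersetCard_eq_empty.2, Finset.sum_empty]
  rw [Finset.card_erase_of_mem (Finset.mem_univ i), Finset.card_univ, Fintype.card_fin]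
  have := i.2
  omega

theorem θ_mul_self (i : Fin N) : θ i * θ i = 0 := by
  rw [θ, Algebra.TensorProduct.tmul_mul_tmul, ExteriorAlgebra.ι_sq_zero, TensorProduct.tmul_zero]

theorem θ_mul_add_swap (i j : Fin N) : θ i * θ j + θ j * θ i = 0 := by
  rw [θ, θ, Algebra.TensorProduct.tmul_mul_tmul, Algebra.TensorProduct.tmul_mul_tmul,
    ← TensorProduct.tmul_add, ExteriorAlgebra.ι_add_mul_swap, TensorProduct.tmul_zero]

theorem sum_mul_sum_eq_zero {R ι : Type*} [Ring R] (s : Finset ι) (t : ι → R)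
    (h : ∀ i, t i * t i = 0) (h' : ∀ i j, t i * t j + t j * t i = 0) :
    (∑ i ∈ s, t i) * ∑ i ∈ s, t i = 0 := by
  classical
  induction s using Finset.induction_on with
  | empty => simp
  | insert a s ha ih =>
    rw [Finset.sum_insert ha, add_mul, mul_add, mul_add, ih, h, zero_add, add_zero,
      Finset.mul_sum, Finset.sum_mul, ← Finset.sum_add_distrib]
    exact Finset.sum_eq_zero fun i _ => h' a i

/-- The superpolynomial `∑ θ_i v_i` of fermionic degree one. -/
def linearForm (v : Fin N → MvPolynomial (Fin N) ℤ) : SuperPoly N := ∑ i, θ i * ofPoly (v i)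

theorem linearForm_mul_self (v : Fin N → MvPolynomial (Fin N) ℤ) :
    linearForm v * linearForm v = 0 := by
  have h : ∀ i j, θ i * ofPoly (v i) * (θ j * ofPoly (v j)) =
      θ i * θ j * (ofPoly (v i) * ofPoly (v j)) := fun i j => by
    rw [mul_assoc, ← mul_assoc (ofPoly (v i)), ofPoly_comm (v i) (θ j), mul_assoc, mul_assoc]
  refine sum_mul_sum_eq_zero _ _ (fun i => ?_) fun i j => ?_
  · rw [h, θ_mul_self, zero_mul]
  · rw [h, h, ofPoly_comm (v j) (ofPoly (v i)), ← add_mul, θ_mul_add_swap, zero_mul]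

theorem linearForm_add (v w : Fin N → MvPolynomial (Fin N) ℤ) :
    linearForm (v + w) = linearForm v + linearForm w := by
  simp only [linearForm, ← Finset.sum_add_distrib, ← mul_add, ← ofPoly_add]
  rfl

theorem exists_eTilde_eq_linearForm (N n : ℕ) :
    ∃ v : Fin N → MvPolynomial (Fin N) ℤ, eTilde N n = linearForm v :=
  ⟨fun i => ∑ J ∈ Finset.powersetCard n (Finset.univ.erase i), ∏ j ∈ J, MvPolynomial.X j, by
    simp only [eTilde, linearForm, ofPoly_sum, Finset.mul_sum]⟩

/-- Polarisation of `linearForm_mul_self`: forms of fermionic degree one square to zero, and so does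
their sum. -/
theorem eTilde_mul_swap (N n k : ℕ) : eTilde N n * eTilde N k + eTilde N k * eTilde N n = 0 := by
  obtain ⟨v, hv⟩ := exists_eTilde_eq_linearForm N n
  obtain ⟨w, hw⟩ := exists_eTilde_eq_linearForm N k
  have := linearForm_mul_self (v + w)
  rwa [linearForm_add, add_mul, mul_add, mul_add, linearForm_mul_self, linearForm_mul_self,
    zero_add, add_zero, ← hv, ← hw] at this

/-- The sign is left unspecified, since only its invertibility matters for passing between `eProd`
and `eProdRev`. -/
theorem exists_units_prod_reverse {R : Type*} [Ring R] (l : List R)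
    (h : ∀ a ∈ l, ∀ b ∈ l, a * b + b * a = 0) :
    ∃ ε : ℤˣ, l.prod = (ε : ℤ) • l.reverse.prod := by
  have hcomm : ∀ (a : R) (l : List R), (∀ b ∈ l, a * b + b * a = 0) →
      ∃ ε : ℤˣ, a * l.prod = (ε : ℤ) • (l.prod * a) := by
    intro a l
    induction l with
    | nil => exact fun _ => ⟨1, by simp⟩
    | cons b l ih =>
      intro hb
      rw [List.forall_mem_cons] at hb
      obtain ⟨ε, hε⟩ := ih hb.2
      refine ⟨-ε, ?_⟩
      rw [List.prod_cons, ← mul_assoc, eq_neg_of_add_eq_zero_left hb.1, neg_mul, mul_assoc, hε,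
        mul_smul_comm, mul_assoc, Units.val_neg, neg_smul]
  induction l with
  | nil => exact ⟨1, by simp⟩
  | cons a l ih =>
    obtain ⟨ε, hε⟩ := ih fun b hb c hc =>
      h b (List.mem_cons_of_mem _ hb) c (List.mem_cons_of_mem _ hc)
    obtain ⟨δ, hδ⟩ := hcomm a l.reverse fun b hb =>
      h a List.mem_cons_self b (List.mem_cons_of_mem _ (List.mem_reverse.1 hb))
    refine ⟨ε * δ, ?_⟩
    rw [List.prod_cons, hε, mul_smul_comm, hδ, smul_smul, List.reverse_cons, List.prod_append,
      List.prod_singleton, Units.val_mul]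

/-! ### Expansion of products of elementary symmetric superpolynomials -/

/-- The content of a filling: the number of columns containing each letter. -/
def content {C : Type*} [Fintype C] (J : C → Finset (Fin N)) : Fin N →₀ ℕ :=
  Finsupp.equivFunOnFinite.symm fun i => (Finset.univ.filter fun c => i ∈ J c).card

theorem prod_prod_X {C : Type*} [Fintype C] (J : C → Finset (Fin N)) :
    ∏ c, ∏ j ∈ J c, (MvPolynomial.X j : MvPolynomial (Fin N) ℤ) =
      MvPolynomial.monomial (content J) 1 := by
  rw [MvPolynomial.monomial_eq, Finsupp.prod_fintype _ _ (by simp), MvPolynomial.C_1, one_mul]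
  have h : ∀ c, ∏ j ∈ J c, (MvPolynomial.X j : MvPolynomial (Fin N) ℤ) =
      ∏ j, if j ∈ J c then MvPolynomial.X j else 1 := fun c => by
    rw [Finset.prod_ite_mem, Finset.univ_inter]
  simp only [h]
  rw [Finset.prod_comm]
  refine Finset.prod_congr rfl fun j _ => ?_
  rw [← Finset.prod_filter, Finset.prod_const]
  rfl

theorem list_prod_θ_mul_ofPoly {k : ℕ} (i : Fin k → Fin N)
    (p : Fin k → MvPolynomial (Fin N) ℤ) :
    (List.ofFn fun a => θ (i a) * ofPoly (p a)).prod =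
      (List.ofFn fun a => θ (i a)).prod * ofPoly (∏ a, p a) := by
  induction k with
  | zero => simp [ofPoly_one]
  | succ k ih =>
    rw [List.ofFn_succ, List.prod_cons, ih, List.ofFn_succ, List.prod_cons, Fin.prod_univ_succ,
      ofPoly_mul, mul_assoc, ← mul_assoc (ofPoly (p 0)), ofPoly_comm (p 0), mul_assoc, mul_assoc]

theorem list_prod_ofPoly {k : ℕ} (p : Fin k → MvPolynomial (Fin N) ℤ) :
    (List.ofFn fun a => ofPoly (p a)).prod = ofPoly (∏ a, p a) := by
  induction k with
  | zero => simp [ofPoly_one]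
  | succ k ih => rw [List.ofFn_succ, List.prod_cons, ih, Fin.prod_univ_succ, ofPoly_mul]

theorem list_prod_sum {R : Type*} [Ring R] {k : ℕ} {ι : Type*} (T : Fin k → Finset ι)
    (g : ι → R) :
    (List.ofFn fun a => ∑ t ∈ T a, g t).prod =
      ∑ c ∈ Fintype.piFinset T, (List.ofFn fun a => g (c a)).prod :=
  (MultilinearMap.mkPiAlgebraFin ℤ k R).map_sum_finset (fun _ => g) T

/-- The fillings of the columns of lengths `A` and `s`, those of lengths `A` carrying a circle. -/
def fillings (N : ℕ) (A s : List ℕ) :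
    Finset ((Fin A.length → Fin N × Finset (Fin N)) × (Fin s.length → Finset (Fin N))) :=
  Fintype.piFinset (fun a => columns N A[a]) ×ˢ
    Fintype.piFinset fun b => Finset.powersetCard s[b] Finset.univ

/-- The boxes of a filling. -/
def fillingBoxes {k l : ℕ} (t : (Fin k → Fin N × Finset (Fin N)) × (Fin l → Finset (Fin N))) :
    Fin k ⊕ Fin l → Finset (Fin N) :=
  Sum.elim (fun a => (t.1 a).2) t.2

/-- Expanding the product selects a column of letters from each factor, together with a circled
letter outside it from each fermionic factor. -/
theorem prod_elementary_eq_sum (N : ℕ) (A s : List ℕ) :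
    (A.map (eTilde N)).prod * (s.map (e N)).prod =
      ∑ t ∈ fillings N A s, monom (content (fillingBoxes t)) fun a => (t.1 a).1 := by
  have hA : A.map (eTilde N) = List.ofFn fun a : Fin A.length =>
      ∑ p ∈ columns N A[a], θ p.1 * ofPoly (∏ j ∈ p.2, MvPolynomial.X j) := by
    simp only [← eTilde_eq_sum]
    exact (List.ofFn_getElem_eq_map A (eTilde N)).symm
  have hs : s.map (e N) = List.ofFn fun b : Fin s.length =>
      ∑ J ∈ Finset.powersetCard s[b] Finset.univ, ofPoly (∏ j ∈ J, MvPolynomial.X j) :=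
    (List.ofFn_getElem_eq_map s (e N)).symm
  rw [hA, hs, list_prod_sum, list_prod_sum, Finset.sum_mul_sum, ← Finset.sum_product']
  refine Finset.sum_congr rfl fun t _ => ?_
  rw [list_prod_θ_mul_ofPoly, list_prod_ofPoly, mul_assoc, ← ofPoly_mul, list_ofFn_θ_mul_ofPoly,
    monom, ← prod_prod_X, Fintype.prod_sum_type]
  rfl

theorem eProdRev_apply (Λ : SuperPartition) (N : ℕ) :
    eProdRev Λ N = (Λ.anti.reverse.map (eTilde N)).prod * (Λ.sym.map (e N)).prod := by
  rw [eProdRev, Pi.mul_apply, Pi.list_prod_apply, Pi.list_prod_apply, List.map_map, List.map_map]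
  rfl

end SuperPoly

end

/-! ### Triangularity -/

noncomputable section

/-- Pigeonhole: the indices from `k` on cannot all be sent strictly beyond `k`, so some `a ≥ k` has
`τ a ≤ k`. -/
theorem le_of_le_comp_perm {m : ℕ} {f g : Fin m → ℕ} (hf : Monotone f) (hg : Monotone g)
    (τ : Equiv.Perm (Fin m)) (h : ∀ a, f a ≤ g (τ a)) (k : Fin m) : f k ≤ g k := by
  obtain ⟨a, hka, hak⟩ : ∃ a, k ≤ a ∧ τ a ≤ k := by
    by_contra! hn
    have hsub : (Finset.Ici k).map τ.toEmbedding ⊆ Finset.Ioi k := by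
      intro b hb
      obtain ⟨a, ha, rfl⟩ := Finset.mem_map.1 hb
      exact Finset.mem_Ioi.2 (hn a (Finset.mem_Ici.1 ha))
    have := Finset.card_le_card hsub
    rw [Finset.card_map, Fin.card_Ici, Fin.card_Ioi] at this
    omega
  exact (hf hka).trans ((h a).trans (hg hak))

theorem perm_eq_one_of_le {m : ℕ} (τ : Equiv.Perm (Fin m)) (h : ∀ a, a ≤ τ a) : τ = 1 := by
  have hsum := Equiv.sum_comp τ fun a : Fin m => (a : ℕ)
  have := (Finset.sum_eq_sum_iff_of_le fun (a : Fin m) (_ : a ∈ Finset.univ) =>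
    (show (a : ℕ) ≤ τ a from h a)).1 hsum.symm
  exact Equiv.ext fun a => (Fin.ext (this a (Finset.mem_univ a))).symm

theorem countP_eq_sum_getElem (l : List ℕ) (i : ℕ) :
    l.countP (fun p => decide (i < p)) = ∑ k : Fin l.length, if i < l[k] then 1 else 0 := by
  rw [countP_lt_eq_sum l i le_rfl]
  refine Finset.sum_congr rfl fun k _ => ?_
  rw [compSeq_of_lt k.2]
  rfl

namespace SuperPartition

theorem star_anti (Λ : SuperPartition) {r r' : ℕ} (h : r ≤ r') :
    compSeq Λ.star r' ≤ compSeq Λ.star r := by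
  refine le_of_forall_lt fun c hc => ?_
  rw [lt_star_iff] at hc ⊢
  omega

theorem star_colLength (Λ : SuperPartition) {a : ℕ} (ha : a ∈ Λ.anti) :
    compSeq Λ.star (Λ.colLength a) = a := by
  refine eq_of_forall_lt_iff fun c => ?_
  rw [lt_star_iff]
  constructor
  · intro h
    by_contra hn
    exact absurd h (not_lt.2 (Λ.colLength_anti (not_lt.1 hn)))
  · exact fun h => Λ.colLength_lt h (List.mem_append_left _ ha)

theorem colLength_eq_card (Λ : SuperPartition) (i : ℕ) :
    Λ.colLength i = (Finset.univ.filter fun x : Fin Λ.anti.reverse.length ⊕ Fin Λ.sym.length =>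
      i < Sum.elim (fun a => Λ.anti.reverse[a]) (fun b => Λ.sym[b]) x).card := by
  rw [Finset.card_filter, Fintype.sum_sum_type, colLength, comp, List.countP_append,
    ← Λ.anti.countP_reverse, countP_eq_sum_getElem, countP_eq_sum_getElem]
  rfl

theorem colLength_anti_strictMono (Λ : SuperPartition) {k : ℕ} (hk : Λ.anti.length = k) :
    StrictMono fun a : Fin k => Λ.colLength (Λ.anti[(a : ℕ)]'(a.2.trans_eq hk.symm)) := by
  intro a b hab
  exact Λ.colLength_lt (List.pairwise_iff_getElem.1 Λ.anti_sorted _ _ _ _ hab)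
    (List.mem_append_left _ (List.getElem_mem _))

theorem anti_reverse_monotone (Λ : SuperPartition) :
    Monotone fun a : Fin Λ.anti.reverse.length => Λ.anti.reverse[a] := by
  have h : Λ.anti.reverse.Pairwise (· < ·) := List.pairwise_reverse.2 Λ.anti_sorted
  intro a b hab
  rcases hab.eq_or_lt with rfl | hab
  · exact le_rfl
  · exact (List.pairwise_iff_getElem.1 h _ _ _ _ hab).le

end SuperPartition

namespace SuperPoly

variable {N : ℕ}

/-- The lengths of the columns to be filled in the expansion of `e_Λ`. -/
def columnLength (Λ : SuperPartition) : Fin Λ.anti.reverse.length ⊕ Fin Λ.sym.length → ℕ :=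
  Sum.elim (fun a => Λ.anti.reverse[a]) (fun b => Λ.sym[b])

theorem mem_fillings {Λ : SuperPartition}
    {t : (Fin Λ.anti.reverse.length → Fin N × Finset (Fin N)) ×
      (Fin Λ.sym.length → Finset (Fin N))} :
    t ∈ fillings N Λ.anti.reverse Λ.sym ↔
      (∀ x, (fillingBoxes t x).card = columnLength Λ x) ∧
        ∀ a, (t.1 a).1 ∉ fillingBoxes t (Sum.inl a) := by
  simp only [fillings, Finset.mem_product, Fintype.mem_piFinset, mem_columns,
    Finset.mem_powersetCard_univ, Sum.forall, fillingBoxes, columnLength, Sum.elim_inl,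
    Sum.elim_inr]
  constructor
  · exact fun h => ⟨⟨fun a => (h.1 a).1, h.2⟩, fun a => (h.1 a).2⟩
  · exact fun h => ⟨fun a => ⟨h.1.1 a, h.2 a⟩, h.1.2⟩

/-- A filling whose monomial occurs in `m_Ω`: its content is dominated by `Λ'`, and if the two
agree the filling is determined up to the positions of the circles. -/
theorem filling_of_coeff_ne_zero {Λ Ω : SuperPartition} (hΩ : Ω.length ≤ N)
    (hk : Ω.anti.length = Λ.anti.reverse.length) {σ : Equiv.Perm ℕ}
    (hσ : ∀ i, compSeq Ω.comp (σ i) = compSeq Ω.star i)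
    (hσ' : ∀ (k : ℕ) (hk : k < Ω.anti.length), σ (Ω.colLength Ω.anti[k]) = k)
    {t : (Fin Λ.anti.reverse.length → Fin N × Finset (Fin N)) ×
      (Fin Λ.sym.length → Finset (Fin N))}
    (ht : t ∈ fillings N Λ.anti.reverse Λ.sym)
    (h : coeff (Ω.expo N) (Fin.castLE (hk.symm.trans_le (Ω.anti_length_le_length.trans hΩ)))
      (monom (content (fillingBoxes t)) fun a => (t.1 a).1) ≠ 0) :
    (∀ k, ∑ i ∈ Finset.range k, compSeq Ω.star i ≤
      ∑ i ∈ Finset.range k, compSeq Λ.conj.star i) ∧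
    (compSeq Ω.star = compSeq Λ.conj.star →
      (∀ x i, i ∈ fillingBoxes t x ↔ σ.symm i < columnLength Λ x) ∧
      ∃ τ : Equiv.Perm (Fin Λ.anti.reverse.length), (∀ a, ((t.1 a).1 : ℕ) = τ a) ∧
        ∀ a, Λ.anti.reverse[a] ≤
          Ω.colLength (Ω.anti[(τ a : ℕ)]'((τ a).2.trans_eq hk.symm))) := by
  obtain ⟨hcont, τ, hτ⟩ := exists_perm_of_coeff_monom_ne_zero h
  rw [mem_fillings] at ht
  -- Relabelling letters by `σ⁻¹` turns the content from the composition of `Ω` into its sorted form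
  -- `Ω*`, the form in which it is compared with row lengths.
  set J : Fin Λ.anti.reverse.length ⊕ Fin Λ.sym.length → Finset ℕ := fun x =>
    ((fillingBoxes t x).map Fin.valEmbedding).map σ.symm.toEmbedding with hJ
  have hcard : ∀ x, (J x).card = columnLength Λ x := fun x => by
    rw [hJ, Finset.card_map, Finset.card_map, ht.1]
  have hmem : ∀ x (i : Fin N), σ.symm i ∈ J x ↔ i ∈ fillingBoxes t x := fun x i => by
    simp [hJ, Fin.val_inj]
  have hstar : ∀ i, (Finset.univ.filter fun x => i ∈ J x).card = compSeq Ω.star i := fun i => by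
    rw [← hσ]
    by_cases hi : σ i < N
    · have h1 : content (fillingBoxes t) ⟨σ i, hi⟩ = compSeq Ω.comp (σ i) := by rw [hcont]; rfl
      rw [← h1]
      change _ = (Finset.univ.filter fun x => (⟨σ i, hi⟩ : Fin N) ∈ fillingBoxes t x).card
      refine congrArg Finset.card (Finset.filter_congr fun x _ => ?_)
      rw [← hmem, Equiv.symm_apply_apply]
    · rw [compSeq_eq_zero (Ω.length_comp.trans_le (hΩ.trans (not_lt.1 hi))), Finset.card_eq_zero,
        Finset.filter_eq_empty_iff]
      intro x _ hx
      simp only [hJ, Finset.mem_map, Equiv.coe_toEmbedding, exists_exists_and_eq_and] at hx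
      obtain ⟨j, -, hj⟩ := hx
      rw [← hj, Equiv.apply_symm_apply] at hi
      exact hi j.2
  have hrow : ∀ i, (Finset.univ.filter fun x => i < (J x).card).card =
      compSeq Λ.conj.star i := fun i => by
    simp only [hcard]
    rw [SuperPartition.star_conj, SuperPartition.colLength_eq_card]
    rfl
  refine ⟨fun k => ?_, fun heq => ?_⟩
  · have := sum_content_le J k
    simpa only [hstar, hrow] using this
  · have hrange : ∀ x, J x = Finset.range (columnLength Λ x) := fun x => by
      rw [← hcard]
      exact filling_eq_range J (fun i => by rw [hstar, hrow, heq]) x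
    have hbox : ∀ x i, i ∈ fillingBoxes t x ↔ σ.symm i < columnLength Λ x := fun x i => by
      rw [← hmem, hrange, Finset.mem_range]
    have hτ' : ∀ a, ((t.1 a).1 : ℕ) = τ a := fun a => congrArg Fin.val (congrFun hτ a)
    -- The circled letter avoids its column, an initial segment after relabelling, so its relabelled
    -- position is at least the column length. By `hσ'` that position is the row of the
    -- corresponding circle of `Ω`.
    refine ⟨hbox, τ, hτ', fun a => ?_⟩
    have h1 := ht.2 a
    rw [hbox, not_lt, hτ'] at h1
    have h2 := hσ' (τ a) ((τ a).2.trans_eq hk.symm)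
    rw [← Equiv.eq_symm_apply] at h2
    rwa [h2]

theorem monoCoeff_eProdRev_eq_sum {Λ Ω : SuperPartition} (hΩ : Ω.length ≤ N)
    (hk : Ω.anti.length = Λ.anti.reverse.length) :
    monoCoeff N Ω (eProdRev Λ N) = ∑ t ∈ fillings N Λ.anti.reverse Λ.sym,
      coeff (Ω.expo N) (Fin.castLE (hk.symm.trans_le (Ω.anti_length_le_length.trans hΩ)))
        (monom (content (fillingBoxes t)) fun a => (t.1 a).1) := by
  rw [eProdRev_apply, prod_elementary_eq_sum, map_sum, monoCoeff_eq_coeff Ω hΩ hk]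

theorem degree_content {C : Type*} [Fintype C] (J : C → Finset (Fin N)) :
    (content J).degree = ∑ c, (J c).card := by
  rw [Finsupp.degree_eq_sum]
  simp only [content, Finsupp.equivFunOnFinite_symm_apply_apply, Finset.card_filter]
  rw [Finset.sum_comm]
  simp

theorem eProdRev_mem_homogeneous (Λ : SuperPartition) (N : ℕ) :
    eProdRev Λ N ∈ homogeneous N Λ.degree Λ.fermionicDegree := by
  rw [eProdRev_apply, prod_elementary_eq_sum]
  refine Submodule.sum_mem _ fun t ht => ?_
  rw [mem_fillings] at ht
  have := monom_mem_homogeneous (content (fillingBoxes t)) fun a => (t.1 a).1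
  have hdeg : ∑ x, (fillingBoxes t x).card = Λ.degree := by
    simp only [ht.1, Fintype.sum_sum_type, columnLength, Sum.elim_inl, Sum.elim_inr]
    rw [SuperPartition.degree, SuperPartition.comp, List.sum_append, ← List.sum_reverse Λ.anti]
    exact congrArg₂ _ (Fin.sum_univ_getElem _) (Fin.sum_univ_getElem _)
  have hferm : Λ.anti.reverse.length = Λ.fermionicDegree := List.length_reverse
  rw [degree_content, hdeg] at this
  rwa [← hferm]

theorem degree_eq_of_monoCoeff_eProdRev_ne_zero {Λ Ω : SuperPartition}
    (h : monoCoeff N Ω (eProdRev Λ N) ≠ 0) :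
    Ω.degree = Λ.degree ∧ Ω.fermionicDegree = Λ.fermionicDegree :=
  mem_SPar_of_monoCoeff_ne_zero (eProdRev_mem_homogeneous Λ N) h

theorem below_conj_of_monoCoeff_eProdRev_ne_zero {Λ Ω : SuperPartition}
    (h : monoCoeff N Ω (eProdRev Λ N) ≠ 0) : Ω = Λ.conj ∨ Ω.Below Λ.conj := by
  have hΩ := length_le_of_monoCoeff_ne_zero h
  obtain ⟨hdeg, hferm⟩ := degree_eq_of_monoCoeff_eProdRev_ne_zero h
  have hk : Ω.anti.length = Λ.anti.reverse.length := by rw [List.length_reverse]; exact hferm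
  rw [monoCoeff_eProdRev_eq_sum hΩ hk] at h
  obtain ⟨t, ht, hne⟩ := Finset.exists_ne_zero_of_sum_ne_zero h
  obtain ⟨σ, hσ, hσ'⟩ := Ω.exists_sorting_perm
  obtain ⟨hle, hstar⟩ := filling_of_coeff_ne_zero hΩ hk hσ hσ' ht hne
  by_cases heq : compSeq Ω.star = compSeq Λ.conj.star
  · obtain ⟨-, τ, -, hτ⟩ := hstar heq
    by_cases hne' : Ω = Λ.conj
    · exact Or.inl hne'
    · refine Or.inr (Or.inr ⟨heq, hferm.trans Λ.fermionicDegree_conj.symm, hne', fun k => ?_⟩)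
      by_cases hkΩ : k < Ω.anti.length
      -- The circle rows of `Ω` and of `Λ'` both increase with the index, so the inequality along
      -- `τ` holds index by index. Lower rows of the common `Ω* = Λ'*` are no longer, which turns it
      -- into the inequality of fermionic parts.
      · have h1 := le_of_le_comp_perm Λ.anti_reverse_monotone
          (Ω.colLength_anti_strictMono hk).monotone τ hτ ⟨k, hkΩ.trans_eq hk⟩
        have hkΛ : k < Λ.conj.anti.length :=
          hkΩ.trans_eq (hferm.trans Λ.fermionicDegree_conj.symm)
        rw [compSeq_of_lt hkΩ, compSeq_of_lt hkΛ, ← Ω.star_colLength (List.getElem_mem hkΩ), heq,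
          ← Λ.conj.star_colLength (List.getElem_mem hkΛ), Λ.anti_conj_getElem k hkΛ]
        exact Λ.conj.star_anti h1
      · rw [compSeq_eq_zero (not_lt.1 hkΩ)]
        exact Nat.zero_le _
  · refine Or.inr (Or.inl ⟨?_, hle, heq⟩)
    rw [SuperPartition.sum_star, SuperPartition.sum_star, hdeg, Λ.degree_conj]

/-- Only the standard filling, transported by the sorting permutation of `Λ'` and with each circle
just at the end of its column, contributes. The reversed order of the fermionic factors makes its
`θ`'s appear in the order of the leading monomial, so the coefficient is `1` and not merely a sign.
-/
theorem monoCoeff_conj_eProdRev {Λ : SuperPartition} (h : Λ.conj.length ≤ N) :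
    monoCoeff N Λ.conj (eProdRev Λ N) = 1 := by
  have hk : Λ.conj.anti.length = Λ.anti.reverse.length := by simp [SuperPartition.conj]
  have hkN := hk.symm.trans_le (Λ.conj.anti_length_le_length.trans h)
  obtain ⟨σ, hσ, hσ'⟩ := Λ.conj.exists_sorting_perm
  have hσk : ∀ a : Fin Λ.anti.reverse.length, σ.symm a = Λ.anti.reverse[a] := fun a => by
    rw [Equiv.symm_apply_eq, Fin.getElem_fin, ← Λ.anti_conj_getElem a (a.2.trans_eq hk.symm),
      hσ' a (a.2.trans_eq hk.symm)]
  let B : Fin Λ.anti.reverse.length ⊕ Fin Λ.sym.length → Finset (Fin N) := fun x =>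
    Finset.univ.filter fun i => σ.symm i < columnLength Λ x
  let t₀ : (Fin Λ.anti.reverse.length → Fin N × Finset (Fin N)) ×
      (Fin Λ.sym.length → Finset (Fin N)) :=
    (fun a => (Fin.castLE hkN a, B (Sum.inl a)), fun b => B (Sum.inr b))
  have hB : fillingBoxes t₀ = B := by
    funext x
    rcases x with a | b <;> rfl
  have hcol : ∀ i, Λ.colLength i = (Finset.univ.filter fun x => i < columnLength Λ x).card :=
    Λ.colLength_eq_card
  have hlt : ∀ x i, i < columnLength Λ x → σ i < N := fun x i hi => by
    have hpos : 0 < compSeq Λ.conj.comp (σ i) := by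
      rw [hσ, Λ.star_conj, hcol]
      exact Finset.card_pos.2 ⟨x, Finset.mem_filter.2 ⟨Finset.mem_univ _, hi⟩⟩
    exact (lt_length_of_compSeq_pos hpos).trans_le (Λ.conj.length_comp.trans_le h)
  have ht₀ : t₀ ∈ fillings N Λ.anti.reverse Λ.sym := by
    rw [mem_fillings, hB]
    refine ⟨fun x => ?_, fun a => ?_⟩
    · have : ((B x).map Fin.valEmbedding).map σ.symm.toEmbedding =
          Finset.range (columnLength Λ x) := by
        ext i
        simp only [B, Finset.mem_map, Finset.mem_filter, Finset.mem_univ, true_and,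
          Equiv.coe_toEmbedding, exists_exists_and_eq_and, Finset.mem_range, Fin.valEmbedding_apply]
        constructor
        · rintro ⟨j, hj, rfl⟩
          exact hj
        · intro hi
          exact ⟨⟨σ i, hlt x i hi⟩, by simpa using hi, by simp⟩
      rw [← Finset.card_range (columnLength Λ x), ← this, Finset.card_map, Finset.card_map]
    · simp only [B, t₀, Finset.mem_filter, Finset.mem_univ, true_and, Fin.val_castLE, hσk]
      exact lt_irrefl _
  have hcont : content (fillingBoxes t₀) = Λ.conj.expo N := by
    ext i
    rw [SuperPartition.expo_apply, ← σ.apply_symm_apply (i : ℕ), hσ, Λ.star_conj, hcol, hB]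
    change (Finset.univ.filter fun x => i ∈ B x).card = _
    simp [B]
  rw [monoCoeff_eProdRev_eq_sum h hk, Finset.sum_eq_single t₀]
  · rw [hcont]
    exact coeff_monom_self _ (Fin.castLE_injective hkN)
  · intro t ht hne
    by_contra h0
    obtain ⟨hbox, τ, hτ, hle⟩ := (filling_of_coeff_ne_zero h hk hσ hσ' ht h0).2 rfl
    -- For `Ω = Λ'` the circle inequality compares values of a single strictly increasing sequence,
    -- hence gives `a ≤ τ a`.
    have hτ1 : τ = 1 := perm_eq_one_of_le τ fun a => by
      refine ((Λ.conj.colLength_anti_strictMono hk).le_iff_le).1 ?_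
      refine le_trans (le_of_eq ?_) (hle a)
      exact Λ.anti_conj_getElem a (a.2.trans_eq hk.symm)
    have hboxes : fillingBoxes t = B := funext fun x => Finset.ext fun i => by
      rw [hbox]; simp [B]
    refine hne (Prod.ext (funext fun a => Prod.ext (Fin.ext ?_) ?_) (funext fun b => ?_))
    · rw [hτ, hτ1]; rfl
    · exact congrFun hboxes (Sum.inl a)
    · exact congrFun hboxes (Sum.inr b)
  · exact fun hn => absurd ht₀ hn

theorem list_prod_mem_symmetric (l : List ℕ) {g : ℕ → SuperPoly N}
    (hg : ∀ n, g n ∈ symmetric N) : (l.map g).prod ∈ symmetric N :=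
  list_prod_mem fun f hf => by
    obtain ⟨n, -, rfl⟩ := List.mem_map.1 hf
    exact hg n

theorem eProdRev_mem_symmetric (Λ : SuperPartition) (N : ℕ) : eProdRev Λ N ∈ symmetric N := by
  rw [eProdRev_apply]
  exact mul_mem (list_prod_mem_symmetric _ (eTilde_mem_symmetric N))
    (list_prod_mem_symmetric _ (e_mem_symmetric N))

theorem restrict_eProdRev (Λ : SuperPartition) (N : ℕ) :
    restrict N (eProdRev Λ (N + 1)) = eProdRev Λ N := by
  rw [eProdRev_apply, eProdRev_apply, map_mul, map_list_prod, map_list_prod, List.map_map,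
    List.map_map]
  congr 3
  · exact funext fun n => restrict_eTilde N n
  · exact funext fun n => restrict_e N n

end SuperPoly

/-! ### Products of elementary functions as symmetric superfunctions -/

theorem eProdRev_mem {n m : ℕ} (Λ : SPar n m) : eProdRev Λ.1 ∈ symSuperfunction n m := fun N => by
  obtain ⟨Λ, rfl, rfl⟩ := Λ
  exact ⟨SuperPoly.eProdRev_mem_homogeneous Λ N, SuperPoly.eProdRev_mem_symmetric Λ N,
    SuperPoly.restrict_eProdRev Λ N⟩

theorem exists_units_eProd (Λ : SuperPartition) :
    ∃ ε : ℤˣ, eProd Λ = (ε : ℤ) • eProdRev Λ := by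
  have h : ∀ n k, eTildeSuper n * eTildeSuper k + eTildeSuper k * eTildeSuper n = 0 :=
    fun n k => funext fun N => SuperPoly.eTilde_mul_swap N n k
  obtain ⟨ε, hε⟩ := SuperPoly.exists_units_prod_reverse (Λ.anti.map eTildeSuper)
    fun a ha b hb => by
      obtain ⟨n, -, rfl⟩ := List.mem_map.1 ha
      obtain ⟨k, -, rfl⟩ := List.mem_map.1 hb
      exact h n k
  refine ⟨ε, ?_⟩
  rw [eProd, hε, eProdRev, smul_mul_assoc, List.map_reverse]

end

/-! ### The main theorem -/

noncomputable section

/-- The support is controlled by `Below` rather than by the Bruhat order, because the induction that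
follows uses its transitivity. -/
theorem eProdRev_eq_mSuper_add {n m : ℕ} (Λ : SPar n m) : ∃ c : SPar n m →₀ ℤ,
    (∀ Ω ∈ c.support, Ω.1.Below Λ.1.conj) ∧
      eProdRev Λ.1 = mSuper Λ.1.conj + c.sum (fun Ω a => a • mSuper Ω.1) := by
  classical
  let Λ' : SPar n m := ⟨Λ.1.conj, Λ.conj_mem⟩
  refine ⟨Finsupp.equivFunOnFinite.symm fun Ω => if Ω = Λ' then 0 else
    SuperPoly.monoCoeff (n + m) Ω.1 (eProdRev Λ.1 (n + m)), fun Ω hΩ => ?_, ?_⟩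
  · rw [Finsupp.mem_support_iff, Finsupp.equivFunOnFinite_symm_apply_apply, ite_ne_left_iff] at hΩ
    refine (SuperPoly.below_conj_of_monoCoeff_eProdRev_ne_zero (Ne.symm hΩ.2)).resolve_left
      fun h => hΩ.1 (Subtype.ext h)
  · rw [Finsupp.sum_fintype _ _ fun Ω => zero_zsmul (mSuper Ω.1)]
    refine (symSuperfunction_eq_sum (eProdRev_mem Λ)).trans ?_
    rw [← Finset.add_sum_erase _ _ (Finset.mem_univ Λ'),
      SuperPoly.monoCoeff_conj_eProdRev Λ'.length_le, one_smul]
    congr 1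
    refine Eq.trans (Finset.sum_congr rfl fun Ω hΩ => ?_) (Finset.sum_erase _ (a := Λ') ?_)
    · rw [Finsupp.equivFunOnFinite_symm_apply_apply, if_neg (Finset.ne_of_mem_erase hΩ)]
    · rw [Finsupp.equivFunOnFinite_symm_apply_apply, if_pos rfl, zero_zsmul]

theorem wellFounded_below (n m : ℕ) :
    WellFounded fun Ω Λ : SPar n m => Ω.1.Below Λ.1 :=
  have : IsTrans (SPar n m) fun Ω Λ => Ω.1.Below Λ.1 := ⟨fun _ _ _ => SuperPartition.Below.trans⟩
  have : Std.Irrefl fun Ω Λ : SPar n m => Ω.1.Below Λ.1 :=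
    ⟨fun Λ => SuperPartition.Below.irrefl Λ.1⟩
  Finite.wellFounded_of_trans_of_irrefl _

/-- Back-substitution along `Below`: the product attached to `Ω'` is `m_Ω` plus terms already known
to lie in `S`. A general subgroup serves both the span in infinitely many variables and, by
evaluation at `N`, the image of `toElementary`. -/
theorem mSuper_mem_of_eProdRev_mem {n m : ℕ} (S : AddSubgroup (∀ N, SuperPoly N))
    (h : ∀ Λ : SPar n m, eProdRev Λ.1 ∈ S) (Ω : SPar n m) : mSuper Ω.1 ∈ S := by
  induction Ω using (wellFounded_below n m).induction with
  | _ Ω ih =>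
    obtain ⟨c, hc, heq⟩ := eProdRev_eq_mSuper_add ⟨Ω.1.conj, Ω.conj_mem⟩
    have hΩ := h ⟨Ω.1.conj, Ω.conj_mem⟩
    simp only [SuperPartition.conj_conj] at hc heq
    rw [heq] at hΩ
    exact (add_mem_cancel_right (sum_mem fun Γ hΓ => zsmul_mem (ih Γ (hc Γ hΓ)) _)).1 hΩ

/-- In a vanishing finite combination, choose an index maximal for `r` among those with nonzero
coefficient; its functional sees no other term. The index type may be infinite. -/
theorem eq_zero_of_triangular {I M : Type*} [AddCommGroup M] (v : I → M) (κ : I → M →+ ℤ)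
    (r : I → I → Prop) (hirr : ∀ i, ¬ r i i) (htrans : ∀ i j k, r i j → r j k → r i k)
    (h₁ : ∀ i, κ i (v i) ≠ 0) (h₂ : ∀ i j, κ j (v i) ≠ 0 → j = i ∨ r j i)
    (s : Finset I) (g : I → ℤ) (h : ∑ i ∈ s, g i • v i = 0) : ∀ i ∈ s, g i = 0 := by
  by_contra! hne
  let T := {i // i ∈ s ∧ g i ≠ 0}
  have : Finite T := Finite.of_injective (fun t : T => (⟨t.1, t.2.1⟩ : s)) fun a b hab =>
    Subtype.ext (congrArg (fun x : s => x.1) hab)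
  have : IsTrans T fun a b => r b.1 a.1 := ⟨fun _ _ _ hab hbc => htrans _ _ _ hbc hab⟩
  have : Std.Irrefl fun a b : T => r b.1 a.1 := ⟨fun a => hirr a.1⟩
  -- The relation is reversed, so a minimal element is an `r`-maximal index.
  have hwf : WellFounded fun a b : T => r b.1 a.1 := Finite.wellFounded_of_trans_of_irrefl _
  obtain ⟨i₀, hi₀⟩ := hne
  obtain ⟨⟨i, his, hig⟩, -, hmax⟩ := hwf.has_min Set.univ ⟨⟨i₀, hi₀⟩, trivial⟩
  have h0 := congrArg (κ i) h
  rw [map_sum, map_zero, Finset.sum_eq_single i, map_zsmul, smul_eq_mul] at h0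
  · exact (mul_ne_zero hig (h₁ i)) h0
  · intro j hjs hji
    rw [map_zsmul, smul_eq_mul]
    by_contra hne
    refine (h₂ j i (right_ne_zero_of_mul hne)).elim (fun h => hji h.symm) fun hr => ?_
    exact hmax ⟨j, hjs, left_ne_zero_of_mul hne⟩ trivial hr
  · exact fun hn => absurd his hn

theorem eProd_mem {n m : ℕ} (Λ : SPar n m) : eProd Λ.1 ∈ symSuperfunction n m := by
  obtain ⟨ε, hε⟩ := exists_units_eProd Λ.1
  rw [hε]
  exact Submodule.smul_mem _ _ (eProdRev_mem Λ)

theorem linearIndependent_eProd (n m : ℕ) :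
    LinearIndependent ℤ fun Λ : SPar n m => (⟨eProd Λ.1, eProd_mem Λ⟩ : symSuperfunction n m) := by
  rw [linearIndependent_iff']
  intro s g hg
  have hg' : ∑ Λ ∈ s, g Λ • eProd Λ.1 = 0 := by
    have := congrArg (symSuperfunction n m).subtype hg
    rw [map_sum, map_zero] at this
    exact this
  have key : ∀ (Λ : SPar n m) (Ω : SuperPartition), ∃ ε : ℤˣ,
      SuperPoly.monoCoeff (n + m) Ω (eProd Λ.1 (n + m)) =
        ε * SuperPoly.monoCoeff (n + m) Ω (eProdRev Λ.1 (n + m)) := fun Λ Ω => by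
    obtain ⟨ε, hε⟩ := exists_units_eProd Λ.1
    exact ⟨ε, by rw [hε, Pi.smul_apply, map_zsmul, smul_eq_mul]⟩
  refine eq_zero_of_triangular (fun Λ : SPar n m => eProd Λ.1)
    -- The functional attached to `Λ` reads the coefficient of `m_{Λ'}`, which equals a sign on
    -- `e_Λ`.
    (fun Λ => (SuperPoly.monoCoeff (n + m) Λ.1.conj).comp (Pi.evalAddMonoidHom _ (n + m)))
    (fun Λ Ω => Λ.1.conj.Below Ω.1.conj) (fun _ => SuperPartition.Below.irrefl _)
    (fun _ _ _ => SuperPartition.Below.trans) (fun Λ => ?_) (fun Λ Ω h => ?_) s g hg'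
  · obtain ⟨ε, hε⟩ := key Λ Λ.1.conj
    change SuperPoly.monoCoeff (n + m) Λ.1.conj (eProd Λ.1 (n + m)) ≠ 0
    rw [hε, SuperPoly.monoCoeff_conj_eProdRev
      (SPar.length_le ⟨Λ.1.conj, Λ.conj_mem⟩), mul_one]
    exact ε.ne_zero
  · change SuperPoly.monoCoeff (n + m) Ω.1.conj (eProd Λ.1 (n + m)) ≠ 0 at h
    obtain ⟨ε, hε⟩ := key Λ Ω.1.conj
    rw [hε] at h
    refine (SuperPoly.below_conj_of_monoCoeff_eProdRev_ne_zero
      (right_ne_zero_of_mul h)).imp_left fun h => Subtype.ext ?_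
    rw [← Ω.1.conj_conj, h, Λ.1.conj_conj]

theorem span_eProd (n m : ℕ) : ⊤ ≤ Submodule.span ℤ
    (Set.range fun Λ : SPar n m => (⟨eProd Λ.1, eProd_mem Λ⟩ : symSuperfunction n m)) := by
  rintro ⟨f, hf⟩ -
  set S := Submodule.span ℤ
    (Set.range fun Λ : SPar n m => (⟨eProd Λ.1, eProd_mem Λ⟩ : symSuperfunction n m))
  have hrev : ∀ Λ : SPar n m,
      eProdRev Λ.1 ∈ (S.map (symSuperfunction n m).subtype).toAddSubgroup := fun Λ => by
    obtain ⟨ε, hε⟩ := exists_units_eProd Λ.1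
    have : eProdRev Λ.1 = (ε : ℤ) • eProd Λ.1 := by
      rw [hε, smul_smul, ← Units.val_mul, Int.units_mul_self, Units.val_one, one_smul]
    rw [this]
    exact Submodule.smul_mem _ _ ⟨_, Submodule.subset_span ⟨Λ, rfl⟩, rfl⟩
  have hmem : f ∈ (S.map (symSuperfunction n m).subtype).toAddSubgroup := by
    rw [symSuperfunction_eq_sum hf]
    exact sum_mem fun Ω _ => zsmul_mem (mSuper_mem_of_eProdRev_mem _ hrev Ω) _
  obtain ⟨g, hg, hgf⟩ := hmem
  have : g = ⟨f, hf⟩ := Subtype.ext hgf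
  rwa [← this]

/-! ### The ring of symmetric superpolynomials in `N` pairs of variables -/

namespace SuperPoly

variable {N : ℕ}

theorem e_eq_ofPoly_esymm (N n : ℕ) : e N n = ofPoly (MvPolynomial.esymm (Fin N) ℤ n) := by
  rw [e, ← ofPoly_sum]
  rfl

/-- The map `x_i ↦ e_{i+1}` on polynomials in `x`. -/
def polyToElementary (N : ℕ) : MvPolynomial (Fin N) ℤ →ₐ[ℤ] SuperPoly N :=
  (Algebra.TensorProduct.includeLeft (R := ℤ) (S := ℤ) (A := MvPolynomial (Fin N) ℤ)
    (B := ExteriorAlgebra ℤ (Fin N → ℤ))).comp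
    (MvPolynomial.aeval fun i : Fin N => MvPolynomial.esymm (Fin N) ℤ (i + 1))

theorem polyToElementary_apply (p : MvPolynomial (Fin N) ℤ) :
    polyToElementary N p =
      ofPoly (MvPolynomial.aeval (fun i : Fin N => MvPolynomial.esymm (Fin N) ℤ (i + 1)) p) := rfl

/-- The map `θ_i ↦ ẽ_i` on the Grassmann algebra. -/
def thetaToElementary (N : ℕ) : ExteriorAlgebra ℤ (Fin N → ℤ) →ₐ[ℤ] SuperPoly N :=
  ExteriorAlgebra.lift ℤ ⟨Fintype.linearCombination ℤ fun i : Fin N => eTilde N i, fun w => by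
    obtain ⟨v, hv⟩ : ∃ v : Fin N → Fin N → MvPolynomial (Fin N) ℤ,
        ∀ i : Fin N, eTilde N i = linearForm (v i) :=
      ⟨fun i => (exists_eTilde_eq_linearForm N i).choose,
        fun i => (exists_eTilde_eq_linearForm N i).choose_spec⟩
    let F : (Fin N → MvPolynomial (Fin N) ℤ) →+ SuperPoly N :=
      AddMonoidHom.mk' linearForm linearForm_add
    have : Fintype.linearCombination ℤ (fun i : Fin N => eTilde N i) w =
        linearForm (∑ i, w i • v i) := by
      change _ = F _
      rw [map_sum, Fintype.linearCombination_apply]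
      refine Finset.sum_congr rfl fun i _ => ?_
      rw [map_zsmul, hv]
      rfl
    exact (congrArg₂ (· * ·) this this).trans (linearForm_mul_self _)⟩

theorem thetaToElementary_ι_single (i : Fin N) :
    thetaToElementary N (ExteriorAlgebra.ι ℤ (Pi.single i 1)) = eTilde N i := by
  rw [thetaToElementary, ExteriorAlgebra.lift_ι_apply, Fintype.linearCombination_apply_single,
    one_smul]

theorem commute_polyToElementary (p : MvPolynomial (Fin N) ℤ) (f : SuperPoly N) :
    Commute (polyToElementary N p) f := ofPoly_comm _ _

/-- The homomorphism `x_i ↦ e_{i+1}`, `θ_i ↦ ẽ_i`. -/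
def toElementary (N : ℕ) : SuperPoly N →ₐ[ℤ] SuperPoly N :=
  Algebra.TensorProduct.lift (polyToElementary N) (thetaToElementary N) fun p y =>
    commute_polyToElementary p (thetaToElementary N y)

theorem toElementary_ofPoly (p : MvPolynomial (Fin N) ℤ) :
    toElementary N (ofPoly p) =
      ofPoly (MvPolynomial.aeval (fun i : Fin N => MvPolynomial.esymm (Fin N) ℤ (i + 1)) p) := by
  refine (Algebra.TensorProduct.lift_tmul _ _ _ _ _).trans ?_
  rw [map_one, mul_one, polyToElementary_apply]

theorem toElementary_x (i : Fin N) : toElementary N (x i) = e N (i + 1) := by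
  rw [x, toElementary_ofPoly, MvPolynomial.aeval_X, e_eq_ofPoly_esymm]

theorem toElementary_θ (i : Fin N) : toElementary N (θ i) = eTilde N i := by
  refine (Algebra.TensorProduct.lift_tmul _ _ _ _ _).trans ?_
  rw [map_one, one_mul, thetaToElementary_ι_single]

theorem monom_eq_mul {k : ℕ} (μ : Fin N →₀ ℕ) (j : Fin k → Fin N) :
    monom μ j = (List.ofFn fun a => θ (j a)).prod * ofPoly (MvPolynomial.monomial μ 1) :=
  (list_ofFn_θ_mul_ofPoly _ _).symm

theorem ofPoly_monomial_mem_adjoin (μ : Fin N →₀ ℕ) :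
    toElementary N (ofPoly (MvPolynomial.monomial μ 1)) ∈
      Algebra.adjoin ℤ (Set.range (fun i : Fin N => e N (i + 1)) ∪
        Set.range (fun i : Fin N => eTilde N i)) := by
  have h : ofPoly (MvPolynomial.monomial μ 1) =
      (List.ofFn fun i : Fin N => x i ^ μ i).prod := by
    have hpow : ∀ i : Fin N, x i ^ μ i = ofPoly (MvPolynomial.X i ^ μ i) := fun i =>
      (map_pow (Algebra.TensorProduct.includeLeft (R := ℤ) (S := ℤ)
        (A := MvPolynomial (Fin N) ℤ) (B := ExteriorAlgebra ℤ (Fin N → ℤ))) _ _).symm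
    simp only [hpow]
    rw [list_prod_ofPoly, MvPolynomial.monomial_eq, Finsupp.prod_fintype _ _ (by simp),
      MvPolynomial.C_1, one_mul]
  rw [h, map_list_prod, List.map_ofFn]
  refine list_prod_mem fun f hf => ?_
  obtain ⟨i, rfl⟩ := List.mem_ofFn.1 hf
  rw [Function.comp_apply, map_pow, toElementary_x]
  exact Subalgebra.pow_mem _
    (Algebra.subset_adjoin (Set.mem_union_left _ (Set.mem_range_self i))) _

theorem toElementary_mem_adjoin (f : SuperPoly N) :
    toElementary N f ∈ Algebra.adjoin ℤ (Set.range (fun i : Fin N => e N (i + 1)) ∪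
        Set.range (fun i : Fin N => eTilde N i)) := by
  refine mem_of_monom_mem ((Subalgebra.toSubring (Algebra.adjoin ℤ
    (Set.range (fun i : Fin N => e N (i + 1)) ∪
      Set.range (fun i : Fin N => eTilde N i)))).toAddSubgroup.comap
        (toElementary N : SuperPoly N →+ SuperPoly N)) (fun k μ j => ?_) f
  change toElementary N (monom μ j) ∈ Algebra.adjoin ℤ _
  rw [monom_eq_mul, map_mul]
  refine mul_mem ?_ (ofPoly_monomial_mem_adjoin μ)
  rw [map_list_prod, List.map_ofFn]
  refine list_prod_mem fun f hf => ?_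
  obtain ⟨a, rfl⟩ := List.mem_ofFn.1 hf
  rw [Function.comp_apply, toElementary_θ]
  exact Algebra.subset_adjoin (Or.inr ⟨j a, rfl⟩)

/-- Factors `ẽ_a` with `a ≥ N` and `e_p` with `p > N` vanish in `N` pairs of variables; all others
are images of generators, with the index of `e` shifted by one. -/
theorem eProdRev_mem_range (Λ : SuperPartition) (N : ℕ) :
    eProdRev Λ N ∈ (toElementary N).range := by
  rw [eProdRev_apply]
  refine mul_mem (list_prod_mem fun f hf => ?_) (list_prod_mem fun f hf => ?_)
  · obtain ⟨a, -, rfl⟩ := List.mem_map.1 hf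
    by_cases ha : a < N
    · exact ⟨θ ⟨a, ha⟩, toElementary_θ _⟩
    · rw [eTilde_eq_zero (not_lt.1 ha)]
      exact zero_mem _
  · obtain ⟨p, hp, rfl⟩ := List.mem_map.1 hf
    have hpos := Λ.sym_pos p hp
    by_cases hpN : p ≤ N
    · have := toElementary_x (⟨p - 1, by omega⟩ : Fin N)
      rw [Nat.sub_add_cancel hpos] at this
      exact ⟨_, this⟩
    · rw [e_eq_zero (not_le.1 hpN)]
      exact zero_mem _

/-- The triangular system is solved in infinitely many variables and then evaluated at `N`, so no
separate argument is needed for those `m_Λ` that vanish there. -/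
theorem mono_mem_range (Λ : SuperPartition) (N : ℕ) : mono N Λ ∈ (toElementary N).range :=
  mSuper_mem_of_eProdRev_mem
    ((Subalgebra.toSubring (toElementary N).range).toAddSubgroup.comap (Pi.evalAddMonoidHom _ N))
    (fun Λ => eProdRev_mem_range Λ.1 N) (⟨Λ, rfl, rfl⟩ : SPar Λ.degree Λ.fermionicDegree)

theorem symmetric_le_range (N : ℕ) : symmetric N ≤ (toElementary N).range := fun f hf => by
  rw [eq_sum_mono_of_support hf (finite_monoCoeff_ne_zero f).toFinset fun Λ hΛ => by
    rwa [Set.Finite.mem_toFinset]]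
  exact sum_mem fun Λ _ => zsmul_mem (mono_mem_range Λ N) _

theorem adjoin_le_symmetric (N : ℕ) :
    Algebra.adjoin ℤ (Set.range (fun i : Fin N => e N (i + 1)) ∪
      Set.range (fun i : Fin N => eTilde N i)) ≤ symmetric N := by
  refine Algebra.adjoin_le ?_
  rintro f (⟨i, rfl⟩ | ⟨i, rfl⟩)
  · exact e_mem_symmetric N _
  · exact eTilde_mem_symmetric N _

theorem range_le_adjoin (N : ℕ) : (toElementary N).range ≤
    Algebra.adjoin ℤ (Set.range (fun i : Fin N => e N (i + 1)) ∪
      Set.range (fun i : Fin N => eTilde N i)) := by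
  rintro _ ⟨f, rfl⟩
  exact toElementary_mem_adjoin f

theorem range_toElementary (N : ℕ) : (toElementary N).range = symmetric N :=
  ((range_le_adjoin N).trans (adjoin_le_symmetric N)).antisymm (symmetric_le_range N)

/-- The superpartition `Λ` such that the monomial `x^μ θ_S` is sent to `e_Λ`. -/
def superPartitionOfMonom (μ : Fin N →₀ ℕ) (S : Finset (Fin N)) : SuperPartition where
  anti := (List.ofFn fun a => (S.orderEmbOfFin rfl a : ℕ)).reverse
  sym := ((Finsupp.toMultiset μ).map fun i : Fin N => (i : ℕ) + 1).sort (· ≥ ·)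
  anti_sorted := by
    rw [List.pairwise_reverse, List.pairwise_ofFn]
    exact fun a b hab => (S.orderEmbOfFin rfl).strictMono hab
  sym_sorted := Multiset.pairwise_sort _ _
  sym_pos := by
    intro p hp
    rw [Multiset.mem_sort, Multiset.mem_map] at hp
    obtain ⟨i, -, rfl⟩ := hp
    exact Nat.succ_pos _

theorem mem_anti_superPartitionOfMonom {μ : Fin N →₀ ℕ} {S : Finset (Fin N)} {a : ℕ} :
    a ∈ (superPartitionOfMonom μ S).anti ↔ ∃ i ∈ S, (i : ℕ) = a := by
  rw [superPartitionOfMonom, List.mem_reverse, List.mem_ofFn]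
  constructor
  · rintro ⟨b, rfl⟩
    exact ⟨_, Finset.orderEmbOfFin_mem _ _ _, rfl⟩
  · rintro ⟨i, hi, rfl⟩
    rw [← Finset.mem_coe, ← Finset.range_orderEmbOfFin S rfl] at hi
    obtain ⟨b, rfl⟩ := hi
    exact ⟨b, rfl⟩

theorem superPartitionOfMonom_injective {μ ν : Fin N →₀ ℕ} {S T : Finset (Fin N)}
    (h : superPartitionOfMonom μ S = superPartitionOfMonom ν T) : (μ, S) = (ν, T) := by
  refine Prod.ext ?_ (Finset.ext fun i => ?_)
  · have h1 := congrArg (fun l : List ℕ => (l : Multiset ℕ)) (congrArg SuperPartition.sym h)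
    simp only [superPartitionOfMonom, Multiset.sort_eq] at h1
    have h2 := Multiset.map_injective (fun i j hij => Fin.ext (Nat.succ_injective hij)) h1
    rw [← Finsupp.toMultiset_toFinsupp μ, h2, Finsupp.toMultiset_toFinsupp]
  · have h1 : ∀ a, a ∈ (superPartitionOfMonom μ S).anti ↔ a ∈ (superPartitionOfMonom ν T).anti :=
      fun a => by rw [h]
    simpa [mem_anti_superPartitionOfMonom, Fin.val_inj] using h1 i

/-- The generators are `ẽ_0, …, ẽ_{N-1}` and `e_1, …, e_N`, so the diagram has at most `N` columns
and the leading coefficient at the conjugate is available in `N` pairs of variables. -/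
theorem length_conj_superPartitionOfMonom (μ : Fin N →₀ ℕ) (S : Finset (Fin N)) :
    (superPartitionOfMonom μ S).conj.length ≤ N := by
  refine SuperPartition.length_conj_le _ (fun a ha => ?_) fun p hp => ?_
  · obtain ⟨i, -, rfl⟩ := mem_anti_superPartitionOfMonom.1 ha
    exact i.2
  · rw [superPartitionOfMonom, Multiset.mem_sort, Multiset.mem_map] at hp
    obtain ⟨i, -, rfl⟩ := hp
    exact i.2

/-- Basis monomials list their `θ`'s by increasing index, which is the order of the fermionic
factors in `eProdRev`, so no sign appears. -/
theorem toElementary_monomBasis (μ : Fin N →₀ ℕ) (S : Finset (Fin N)) :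
    toElementary N (monomBasis N (μ, S)) = eProdRev (superPartitionOfMonom μ S) N := by
  have hsym : ∀ l : List ℕ, (l.map (e N)).prod =
      ofPoly (l.map (MvPolynomial.esymm (Fin N) ℤ)).prod := by
    intro l
    induction l with
    | nil => rfl
    | cons a l ih => rw [List.map_cons, List.prod_cons, ih, List.map_cons, List.prod_cons,
        ofPoly_mul, e_eq_ofPoly_esymm]
  rw [monomBasis_apply μ S rfl, monom_eq_mul, map_mul, eProdRev_apply, hsym, toElementary_ofPoly]
  congr 1
  · rw [map_list_prod, List.map_ofFn, superPartitionOfMonom, List.reverse_reverse, List.map_ofFn]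
    congr 2
    exact funext fun a => toElementary_θ _
  · congr 1
    rw [MvPolynomial.aeval_monomial, map_one, one_mul, ← Multiset.prod_coe, ← Multiset.map_coe,
      superPartitionOfMonom, Multiset.sort_eq, Multiset.map_map, Finsupp.toMultiset_map,
      Finsupp.prod_toMultiset, Finsupp.prod_mapDomain_index (fun _ => pow_zero _)
        (fun _ _ _ => pow_add _ _ _)]
    rfl

/-- The images of basis monomials belong to pairwise distinct superpartitions and have leading
coefficient `1` at the conjugates, so triangularity makes them independent. -/
theorem toElementary_injective (N : ℕ) : Function.Injective (toElementary N) := by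
  rw [injective_iff_map_eq_zero]
  intro f hf
  have hsum := (monomBasis N).linearCombination_repr f
  rw [Finsupp.linearCombination_apply, Finsupp.sum] at hsum
  have h0 : ∑ p ∈ ((monomBasis N).repr f).support,
      (monomBasis N).repr f p • eProdRev (superPartitionOfMonom p.1 p.2) N = 0 := by
    rw [← hf]
    conv_rhs => rw [← hsum]
    rw [map_sum]
    refine Finset.sum_congr rfl fun p _ => ?_
    rw [← toElementary_monomBasis]
    exact (map_intCast_smul (toElementary N) ℤ ℤ _ _).symm
  have hzero := eq_zero_of_triangular
    (fun p : (Fin N →₀ ℕ) × Finset (Fin N) => eProdRev (superPartitionOfMonom p.1 p.2) N)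
    (fun p => monoCoeff N (superPartitionOfMonom p.1 p.2).conj)
    (fun p q => (superPartitionOfMonom p.1 p.2).conj.Below (superPartitionOfMonom q.1 q.2).conj)
    (fun _ => SuperPartition.Below.irrefl _) (fun _ _ _ => SuperPartition.Below.trans)
    (fun p => by
      rw [monoCoeff_conj_eProdRev (length_conj_superPartitionOfMonom _ _)]
      exact one_ne_zero)
    (fun p q h => (below_conj_of_monoCoeff_eProdRev_ne_zero h).imp_left fun h => by
      refine superPartitionOfMonom_injective ?_
      rw [← SuperPartition.conj_conj (superPartitionOfMonom q.1 q.2), h,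
        SuperPartition.conj_conj]) _ _ h0
  refine (monomBasis N).ext_elem fun p => ?_
  rw [map_zero, Finsupp.zero_apply]
  by_contra hp
  exact hp (hzero p (Finsupp.mem_support_iff.2 hp))

end SuperPoly

end

theorem theorem3p1 :
    (∀ (n m : ℕ) (Λ : SPar n m), ∃ c : SPar n m →₀ ℤ,
      (∀ Ω ∈ c.support, Ω.1.BruhatLT Λ.1.conj) ∧
      eProdRev Λ.1 = mSuper Λ.1.conj + c.sum (fun Ω a => a • mSuper Ω.1)) ∧
    (∀ n m : ℕ, ∃ b : Module.Basis (SPar n m) ℤ (symSuperfunction n m),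
      ∀ Λ : SPar n m, (b Λ : ∀ N, SuperPoly N) = eProd Λ.1) ∧
    (∀ N : ℕ,
      SuperPoly.symmetric N =
        Algebra.adjoin ℤ (Set.range (fun i : Fin N => SuperPoly.e N (i + 1)) ∪
          Set.range (fun i : Fin N => SuperPoly.eTilde N i)) ∧
      ∃ Φ : SuperPoly N ≃ₐ[ℤ] SuperPoly.symmetric N,
        (∀ i : Fin N, (Φ (SuperPoly.x i) : SuperPoly N) = SuperPoly.e N (i + 1)) ∧
        (∀ i : Fin N, (Φ (SuperPoly.θ i) : SuperPoly N) = SuperPoly.eTilde N i)) := by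
  refine ⟨fun n m Λ => ?_, fun n m => ?_, fun N => ⟨?_, ?_⟩⟩
  · obtain ⟨c, hc, h⟩ := eProdRev_eq_mSuper_add Λ
    exact ⟨c, fun Ω hΩ => (hc Ω hΩ).bruhatLT, h⟩
  · exact ⟨Module.Basis.mk (linearIndependent_eProd n m) (span_eProd n m), fun Λ => by
      rw [Module.Basis.mk_apply]⟩
  · exact ((SuperPoly.symmetric_le_range N).trans (SuperPoly.range_le_adjoin N)).antisymm
      (SuperPoly.adjoin_le_symmetric N)
  · exact ⟨(AlgEquiv.ofInjective (SuperPoly.toElementary N)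
      (SuperPoly.toElementary_injective N)).trans
        (Subalgebra.equivOfEq _ _ (SuperPoly.range_toElementary N)),
      SuperPoly.toElementary_x, SuperPoly.toElementary_θ⟩
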